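/- Consider the stochastic multi-armed bandit with predictions $1,\dots,K$. Predicting $i$ at time $t$ gives a reward $r_t(i)\in[0,1]$; the rewards $(r_t(i))_{t\ge1}$ are i.i.d. with mean $\mu_i$ and the rewards of different predictions are independent. The reward of the prediction $a_s$ made at time $s$ is revealed, together with its time stamp, at the end of time $s+\tau_{a_s,s}$, where the delays $\tau_{i,s}\in\{0,1,2,\dots\}$ (jointly with the internal randomization of the forecaster, if any) are independent of the rewards. Let $\mu^*=\max_i\mu_i$, $\Delta_i=\mu^*-\mu_i$, $\mathbb E[R_n]=\mathbb E\sum_{t=1}^n(\mu^*-\mu_{a_t})$. Let $T_i(t)$ be the number of times $i$ is predicted up to time $t$, $S_i(t)$ the number of rewards of $i$ revealed by the end of time $t$, and $G^*_{i,n}=\max_{1\le t\le n}(T_i(t-1)-S_i(t-1))$. Let $d(p,q)=p\log\frac pq+(1-p)\log\frac{1-p}{1-q}$ be the Bernoulli KL divergence (with values in $[0,\infty]$ and the usual conventions). The Delayed-KL-UCB algorithm predicts, at each time $t\ge3$, an $a_t$ that maximizes over $i$ $$B_{i,S_i(t-1),t},\qquad B_{i,s,t}=\max\{q\in[\hat\mu_{i,s},1]: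 s\,d(\hat\mu_{i,s},q)\le\log t+3\log\log t\},$$ where $\hat\mu_{i,s}$ is the mean of the first $s$ revealed rewards of $i$ (and $\hat\mu_{i,0}=0$); ties, and the predictions at $t=1,2$, are arbitrary, as long as they depend only on the information revealed so far and on the internal randomization. When all delays are zero this is the KL-UCB algorithm. For all $K$ and $\mu_1,\dots,\mu_K$ there are a constant $C_1>0$ and functions $C_2,\beta:(0,\infty)\to(0,\infty)$ with $C_2(\varepsilon)=O(\varepsilon^{-2})$ and $\beta(\varepsilon)=O(\varepsilon^2)$ as $\varepsilon\to0$, depending only on $\mu_1,\dots,\mu_K$, such that for every such problem with these means, every $\varepsilon>0$ and every $n\ge3$: (i) without delays ($\tau\equiv0$), the expected regret of KL-UCB satisfies $$\mathbb E[R_n]\le\sum_{i:\Delta_i>0}\Delta_i\Big(\frac{\log n}{d(\mu_i,\mu^*)}(1+\varepsilon)+C_1\log\log n+\frac{C_2(\varepsilon)}{n^{\beta(\varepsilon)}}\Big);$$ (ii) with the same $C_1,C_2,\beta$, for arbitrary delays as above, the expected regret of Delayed-KL-UCB satisfies $$\mathbb E[R_n]\le\sum_{i:\Delta_i>0}\Delta_i\Big(\frac{\log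 n}{d(\mu_i,\mu^*)}(1+\varepsilon)+C_1\log\log n\Big)+\sum_{i=1}^K\Delta_i\Big(\frac{C_2(\varepsilon)}{n^{\beta(\varepsilon)}}\mathbb E[G^*_{i,n}]+\mathbb E[G^*_{i,n}]+1\Big).$$ -/

import Mathlib

open MeasureTheory ProbabilityTheory
open scoped ENNReal

namespace DelayedBandit

/-- Kullback-Leibler divergence `d(p, q)` of the Bernoulli distributions with parameters `p` and `q`,
with the usual conventions `0 log 0 = 0 log (0 / 0) = 0` and `x log (x / 0) = ∞` for `x > 0`. -/
noncomputable def klBer (p q : ℝ) : ℝ≥0∞ :=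
  if (q = 0 ∧ p ≠ 0) ∨ (q = 1 ∧ p ≠ 1) then ⊤
  else ENNReal.ofReal (p * Real.log (p / q) + (1 - p) * Real.log ((1 - p) / (1 - q)))

/-- The KL-UCB upper confidence bound at time instant `t`, computed from `s` samples with empirical
mean `m`: the largest `q ∈ [m, 1]` such that `s d(m, q) ≤ log t + 3 log log t`. It is only used
for `t ≥ 3`, where the right-hand side is positive. -/
noncomputable def klIndex (s : ℕ) (m : ℝ) (t : ℕ) : ℝ :=
  sSup {q : ℝ | q ∈ Set.Icc m 1 ∧
    (s : ℝ≥0∞) * klBer m q ≤ ENNReal.ofReal (Real.log t + 3 * Real.log (Real.log t))}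

/-- What the forecaster knows about one past round: its prediction, whether the feedback has
arrived, and, if it has, the delay and the reward (`0` and `0` otherwise). -/
abbrev Record (K : ℕ) : Type := Fin K × Bool × ℕ × ℝ

/-- The record, available when the prediction of round `t` is made, of an earlier round `s` in
which `i` was predicted, with delay `d` and reward `r`. The feedback arrives at the end
of round `s + d`. -/
def record {K : ℕ} (t s : ℕ) (i : Fin K) (d : ℕ) (r : ℝ) : Record K :=
  if s + d < t then (i, true, d, r) else (i, false, 0, 0)

/-- A forecaster. Rounds are numbered from `0`: round `t` is the time instant `t + 1`. The prediction
in round `t` is a function of the records of the earlier rounds and of an internal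
randomization with values in `S` (used, for instance, for breaking ties). -/
structure Forecaster (K : ℕ) (S : Type*) [MeasurableSpace S] where
  predict : (t : ℕ) → (Fin t → Record K) → S → Fin K
  measurable_predict : ∀ t, Measurable fun p : (Fin t → Record K) × S => predict t p.1 p.2

/-- The number of feedbacks for `i` contained in a history. -/
def numObserved {K t : ℕ} (h : Fin t → Record K) (i : Fin K) : ℕ :=
  (Finset.univ.filter fun s => (h s).1 = i ∧ (h s).2.1 = true).card

/-- The empirical mean of the observed rewards of `i` (`0` if there are none). -/
noncomputable def empMean {K t : ℕ} (h : Fin t → Record K) (i : Fin K) : ℝ :=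
  (∑ s ∈ Finset.univ.filter (fun s => (h s).1 = i ∧ (h s).2.1 = true), (h s).2.2.2) /
    numObserved h i

/-- The Delayed-KL-UCB algorithm: at each time instant `t + 1 ≥ 3` it predicts some `i` whose upper
confidence bound, computed from the observed rewards only, is largest; ties are broken
arbitrarily. At the time instants `1` and `2` the level `log t + 3 log log t` is undefined or negative,
so that the rule says nothing, and the prediction is arbitrary. -/
def IsDelayedKLUCB {K : ℕ} {S : Type*} [MeasurableSpace S] (F : Forecaster K S) : Prop :=
  ∀ (t : ℕ) (h : Fin t → Record K) (u : S), 3 ≤ t + 1 → ∀ j : Fin K,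
    klIndex (numObserved h j) (empMean h j) (t + 1) ≤
      klIndex (numObserved h (F.predict t h u)) (empMean h (F.predict t h u)) (t + 1)

section Run

variable {K : ℕ} {S : Type*} [MeasurableSpace S] (F : Forecaster K S)
  (x : Fin K → ℕ → ℝ) (d : Fin K → ℕ → ℕ) (u : S)

/-- The predictions made by `F`, if predicting `i` in round `t` gives the reward `x i t`, revealed with
delay `d i t`, and the internal randomization is `u`. -/
def run (t : ℕ) : Fin K :=
  F.predict t (fun s => record t s (run s) (d (run s) s) (x (run s) s)) u
termination_by t
decreasing_by all_goals exact s.isLt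

/-- `T_i`: the number of times `i` is predicted in the first `t` rounds. -/
def plays (i : Fin K) (t : ℕ) : ℕ :=
  ((Finset.range t).filter fun s => run F x d u s = i).card

/-- `S_i`: the number of feedbacks for `i` received by the end of the first `t` rounds. -/
def received (i : Fin K) (t : ℕ) : ℕ :=
  ((Finset.range t).filter fun s => run F x d u s = i ∧ s + d i s < t).card

/-- `G*_{i,n}`: the maximum, over the first `n` predictions, of the number of feedbacks for `i` that
are missing when the prediction is made. -/
def maxMissing (i : Fin K) (n : ℕ) : ℕ :=
  (Finset.range n).sup fun t => plays F x d u i t - received F x d u i t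

end Run

/-- The stochastic multi-armed bandit with expected rewards `μ` and delayed feedback: predicting `i` in
round `t` yields the reward `X i t`, revealed with delay `τ i t`. The rewards lie in `[0, 1]`, are
i.i.d. for each prediction and independent for different ones; the delays and the
randomization `U` of the forecaster are independent of the rewards. -/
structure IsDelayedBandit {K : ℕ} {Ω S : Type*} [MeasurableSpace Ω] [MeasurableSpace S]
    (P : Measure Ω) (μ : Fin K → ℝ) (X : Fin K → ℕ → Ω → ℝ) (τ : Fin K → ℕ → Ω → ℕ) (U : Ω → S) :
    Prop where
  measurable_reward : ∀ i t, Measurable (X i t)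
  measurable_delay : ∀ i t, Measurable (τ i t)
  measurable_seed : Measurable U
  mem_Icc : ∀ i t, ∀ᵐ ω ∂P, X i t ω ∈ Set.Icc (0 : ℝ) 1
  identDistrib : ∀ i t, IdentDistrib (X i t) (X i 0) P P
  indep_rewards : iIndepFun (fun p : Fin K × ℕ => X p.1 p.2) P
  mean : ∀ i t, ∫ ω, X i t ω ∂P = μ i
  indep_delays : IndepFun (fun ω i t => X i t ω) (fun ω => ((fun i t => τ i t ω), U ω)) P

section Expectations

variable {K : ℕ} {Ω S : Type*} [MeasurableSpace Ω] [MeasurableSpace S]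

/-- The gap `Δ_i = μ* - μ_i`, where `μ*` is the largest entry of `μ`. -/
noncomputable def gap (μ : Fin K → ℝ) (i : Fin K) : ℝ := (⨆ j, μ j) - μ i

/-- The expected regret `E[R_n] = E[∑_t (μ* - μ_{a_t})]` after `n` time instants. -/
noncomputable def expRegret (P : Measure Ω) (μ : Fin K → ℝ) (X : Fin K → ℕ → Ω → ℝ)
    (τ : Fin K → ℕ → Ω → ℕ) (U : Ω → S) (F : Forecaster K S) (n : ℕ) : ℝ :=
  ∫ ω, ∑ t ∈ Finset.range n,
    gap μ (run F (fun i t => X i t ω) (fun i t => τ i t ω) (U ω) t) ∂P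

/-- `E[G*_{i,n}]`. -/
noncomputable def expMaxMissing (P : Measure Ω) (X : Fin K → ℕ → Ω → ℝ)
    (τ : Fin K → ℕ → Ω → ℕ) (U : Ω → S) (F : Forecaster K S) (i : Fin K) (n : ℕ) : ℝ :=
  ∫ ω, (maxMissing F (fun i t => X i t ω) (fun i t => τ i t ω) (U ω) i n : ℝ) ∂P

/-- `log n / d(μ_i, μ*)`, which is `0` when `d(μ_i, μ*) = ∞`. -/
noncomputable def leadingTerm (μ : Fin K → ℝ) (i : Fin K) (n : ℕ) : ℝ :=
  Real.log n * (klBer (μ i) (⨆ j, μ j))⁻¹.toReal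

end Expectations

end DelayedBandit

/-! Everything rests on one estimate, `exists_integral_plays_le_leadingTerm`: a suboptimal `i` is
predicted at most `log n / d(μ_i, μ*) + C log log n + E[G*]` times in expectation. It has neither a
factor `1 + ε` nor a polynomial remainder, so `C₂` and `β` may be chosen freely, and `G*` vanishes
without delays.

Fix an optimal `j`. If `i` is predicted by the rule, then either the index of `j` is below `μ_j`, or
the index of `i` is at least `μ_j` (`plays_le`).

The first event has probability at most `15 / (t log t)` at time instant `t` (`prob_index_lt_le`):
peeling over the number of received samples reduces it to `O(log² t)` Chernoff events of probability
at most `e / (t log³ t)` each. Summing over `t` gives `log log n`.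

For the second event, `d(·, μ_j)` is convex and hence lies above its tangent at `μ_i`. An index of
at least `μ_j` therefore forces the sum of `φ` over the received rewards of `i` to be at most `L =
log n + 3 log log n`, where `φ` is the tangent, an affine function with mean `g = d(μ_i, μ_j)` under
the reward distribution of `i`. These sums form a random walk with bounded increments and drift `g`.
The expected number of its steps up to its last visit below `L` is at most `L / g` plus a constant
(`exists_lastPassage`): Wald's identity bounds the steps before the first passage, an exponential
weight those between the first and the last. Working in expectation up to the last passage is what
avoids the loss of `1 + ε`. The number of plays exceeds the number of received feedbacks by at most
`G*`.

Delays and adaptivity enter only through `isSampled`. Feedbacks are listed in order of arrival; a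
reward influences no prediction before it is revealed, so each newly revealed reward is independent
of the earlier ones and of the fact that it is revealed now. The martingale arguments use nothing
else. The means `0` and `1`, where the tangent or the divergence degenerates, are treated
separately. -/

namespace DelayedBandit

/-! ### Bernoulli divergence: tangents, monotonicity, Chernoff exponents -/

/-- The real-valued Bernoulli Kullback-Leibler divergence, correct when `0 < q < 1`. -/
noncomputable def klReal (p q : ℝ) : ℝ :=
  p * Real.log (p / q) + (1 - p) * Real.log ((1 - p) / (1 - q))

/-- The partial derivative of `klReal` in its first argument. -/
noncomputable def klSlope (p q : ℝ) : ℝ :=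
  Real.log (p / q) - Real.log ((1 - p) / (1 - q))

/-- The exploration level `log t + 3 log log t`. -/
noncomputable def level (t : ℕ) : ℝ := Real.log t + 3 * Real.log (Real.log t)

lemma klBer_eq {p q : ℝ} (h0 : 0 < q) (h1 : q < 1) : klBer p q = ENNReal.ofReal (klReal p q) := by
  unfold klBer klReal
  rw [if_neg]
  rintro (h | h)
  · exact h0.ne' h.1
  · exact h1.ne h.1

lemma mul_log_div_eq (p : ℝ) {q : ℝ} (hq : q ≠ 0) :
    p * Real.log (p / q) = p * Real.log p - p * Real.log q := by
  rcases eq_or_ne p 0 with rfl | hp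
  · simp
  · rw [Real.log_div hp hq]; ring

lemma sub_le_mul_log_div {p q : ℝ} (hp : 0 ≤ p) (hq : 0 < q) : p - q ≤ p * Real.log (p / q) := by
  rcases hp.eq_or_lt with rfl | hp
  · simpa using hq.le
  · have h := Real.one_sub_inv_le_log_of_pos (div_pos hp hq)
    have h2 := mul_le_mul_of_nonneg_left h hp.le
    calc p - q = p * (1 - (p / q)⁻¹) := by field_simp
      _ ≤ _ := h2

lemma klReal_nonneg {p q : ℝ} (hp0 : 0 ≤ p) (hp1 : p ≤ 1) (hq0 : 0 < q) (hq1 : q < 1) :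
    0 ≤ klReal p q := by
  have h1 := sub_le_mul_log_div hp0 hq0
  have h2 := sub_le_mul_log_div (sub_nonneg.2 hp1) (sub_pos.2 hq1)
  unfold klReal
  linarith

/-- Three-point identity of a Bregman divergence. Since `klReal p z` is nonnegative for `p` in `[0,
1]`, it contains the convexity of `klReal · q`; the monotonicity statements below are also read off
from it. -/
lemma klReal_tangent (p : ℝ) {z q : ℝ} (hz0 : 0 < z) (hz1 : z < 1) (hq0 : 0 < q) (hq1 : q < 1) :
    klReal p q = klReal p z + klReal z q + (p - z) * klSlope z q := by
  have hz1' : 1 - z ≠ 0 := (sub_pos.2 hz1).ne'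
  have hq1' : 1 - q ≠ 0 := (sub_pos.2 hq1).ne'
  unfold klReal klSlope
  rw [mul_log_div_eq p hq0.ne', mul_log_div_eq p hz0.ne', mul_log_div_eq (1 - p) hq1',
    mul_log_div_eq (1 - p) hz1', Real.log_div hz0.ne' hq0.ne', Real.log_div hz1' hq1']
  ring

lemma klReal_self (p : ℝ) : klReal p p = 0 := by
  unfold klReal
  rcases eq_or_ne p 0 with rfl | hp
  · simp
  rcases eq_or_ne (1 - p) 0 with hp' | hp'
  · simp [hp', hp]
  · simp [hp, hp']

lemma klSlope_nonpos {p q : ℝ} (hp0 : 0 < p) (hpq : p ≤ q) (hq1 : q < 1) : klSlope p q ≤ 0 := by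
  have hq0 : 0 < q := hp0.trans_le hpq
  have h1 : Real.log (p / q) ≤ 0 := Real.log_nonpos (by positivity) ((div_le_one hq0).2 hpq)
  have h2 : 0 ≤ Real.log ((1 - p) / (1 - q)) :=
    Real.log_nonneg ((one_le_div (sub_pos.2 hq1)).2 (by linarith))
  unfold klSlope
  linarith

/-- The tangent is taken at the larger point `m`, because `z = 0` is allowed and the tangent
identity needs an interior base point. -/
lemma klReal_anti_left {z m q : ℝ} (hz : 0 ≤ z) (hzm : z ≤ m) (hmq : m ≤ q) (hq1 : q < 1) :
    klReal m q ≤ klReal z q := by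
  rcases hz.eq_or_lt with rfl | hz
  · rcases hzm.eq_or_lt with rfl | hm
    · exact le_rfl
    · have := klReal_tangent 0 hm (hmq.trans_lt hq1) (hm.trans_le hmq) hq1
      have h1 := klReal_nonneg le_rfl zero_le_one hm (hmq.trans_lt hq1)
      have h2 := klSlope_nonpos hm hmq hq1
      nlinarith
  · have hm : 0 < m := hz.trans_le hzm
    have := klReal_tangent z hm (hmq.trans_lt hq1) (hm.trans_le hmq) hq1
    have h1 := klReal_nonneg hz.le (by linarith : z ≤ 1) hm (hmq.trans_lt hq1)
    have h2 := klSlope_nonpos hm hmq hq1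
    nlinarith

lemma klReal_mono_right {m p q : ℝ} (hmp : m ≤ p) (hp : 0 < p) (hpq : p ≤ q)
    (hq1 : q < 1) : klReal m p ≤ klReal m q := by
  have := klReal_tangent m hp (hpq.trans_lt hq1) (hp.trans_le hpq) hq1
  have h1 := klReal_nonneg hp.le (by linarith : p ≤ 1) (hp.trans_le hpq) hq1
  have h2 := klSlope_nonpos hp hpq hq1
  nlinarith

lemma klReal_pos {p q : ℝ} (hp0 : 0 ≤ p) (hpq : p < q) (hq1 : q < 1) : 0 < klReal p q := by
  have hq0 : 0 < q := hp0.trans_lt hpq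
  rcases hp0.eq_or_lt with rfl | hp
  · unfold klReal
    have : 0 < Real.log (1 / (1 - q)) := Real.log_pos ((one_lt_div (sub_pos.2 hq1)).2 (by linarith))
    simpa using this
  · obtain ⟨r, hr1, hr2⟩ := exists_between hpq
    have hr : 0 < r := hp.trans hr1
    have := klReal_tangent p hr (hr2.trans hq1) hq0 hq1
    have h1 := klReal_nonneg hp.le (by linarith : p ≤ 1) hr (hr2.trans hq1)
    have h2 := klReal_nonneg hr.le (by linarith : r ≤ 1) hq0 hq1
    have h3 : klSlope r q < 0 := by
      have h1 : Real.log (r / q) < 0 := Real.log_neg (by positivity) ((div_lt_one hq0).2 hr2)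
      have h2 : 0 ≤ Real.log ((1 - r) / (1 - q)) :=
        Real.log_nonneg ((one_le_div (sub_pos.2 hq1)).2 (by linarith))
      unfold klSlope
      linarith
    nlinarith

lemma continuous_klReal_left {q : ℝ} (hq0 : 0 < q) (hq1 : q < 1) :
    Continuous fun p => klReal p q := by
  have hq1' : 1 - q ≠ 0 := (sub_pos.2 hq1).ne'
  have : (fun p => klReal p q) = fun p => p * Real.log p - p * Real.log q +
      ((1 - p) * Real.log (1 - p) - (1 - p) * Real.log (1 - q)) := by
    funext p
    unfold klReal
    rw [mul_log_div_eq p hq0.ne', mul_log_div_eq (1 - p) hq1']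
  rw [this]
  have h := Real.continuous_mul_log
  have h2 : Continuous fun p : ℝ => (1 - p) * Real.log (1 - p) := h.comp (by fun_prop)
  fun_prop

lemma continuousAt_klReal_right (m : ℝ) {q : ℝ} (hq0 : 0 < q) (hq1 : q < 1) :
    ContinuousAt (fun q => klReal m q) q := by
  have hq1' : 1 - q ≠ 0 := (sub_pos.2 hq1).ne'
  have : (fun q => klReal m q) =ᶠ[nhds q] fun q => m * Real.log m - m * Real.log q +
      ((1 - m) * Real.log (1 - m) - (1 - m) * Real.log (1 - q)) := by
    filter_upwards [Ioo_mem_nhds hq0 hq1] with r hr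
    unfold klReal
    rw [mul_log_div_eq m hr.1.ne', mul_log_div_eq (1 - m) (sub_pos.2 hr.2).ne']
  refine ContinuousAt.congr ?_ this.symm
  have h1 : ContinuousAt (fun q : ℝ => Real.log q) q := Real.continuousAt_log hq0.ne'
  have h2 : ContinuousAt (fun q : ℝ => Real.log (1 - q)) q :=
    ContinuousAt.log (by fun_prop) hq1'
  fun_prop

/-- Half-lines `{m < q : y < d(m, q)}` are described by a single Chernoff exponent. -/
lemma exists_chernoff {q y : ℝ} (hq0 : 0 < q) (hq1 : q < 1) (hy : 0 < y) :
    ∃ l : ℝ, ∀ m, 0 ≤ m → m < q → y < klReal m q →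
      y ≤ l * m - Real.log (1 - q + q * Real.exp l) := by
  by_cases hz : ∃ z, 0 < z ∧ z < q ∧ klReal z q = y
  · obtain ⟨z, hz0, hzq, hzy⟩ := hz
    have hz1 : z < 1 := hzq.trans hq1
    have hz1' : 0 < 1 - z := sub_pos.2 hz1
    have hq1' : 0 < 1 - q := sub_pos.2 hq1
    -- The slope at the threshold `z` is the optimal exponent: the Bernoulli moment generating
    -- function there equals `(1 - q) / (1 - z)`, so the line takes the value `y` at `z` and is
    -- nonincreasing.
    refine ⟨klSlope z q, fun m hm hmq hmy => ?_⟩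
    have hmz : m ≤ z := by
      by_contra! h
      have := klReal_anti_left hz0.le h.le hmq.le hq1
      linarith
    have hexp : 1 - q + q * Real.exp (klSlope z q) = (1 - q) / (1 - z) := by
      unfold klSlope
      rw [Real.exp_sub, Real.exp_log (by positivity), Real.exp_log (by positivity)]
      field_simp
      ring
    have hs := klSlope_nonpos hz0 hzq.le hq1
    have : klReal z q = klSlope z q * z - Real.log ((1 - q) / (1 - z)) := by
      unfold klReal klSlope
      rw [Real.log_div hz1'.ne' hq1'.ne', Real.log_div hq1'.ne' hz1'.ne']
      ring
    rw [hexp]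
    nlinarith
  -- No admissible `m` exists in this case: by the intermediate value theorem it would produce a
  -- forbidden `z` between `m` and `q`. Any exponent will do.
  · refine ⟨0, fun m hm hmq hmy => ?_⟩
    exfalso
    apply hz
    have hc := (continuous_klReal_left hq0 hq1).continuousOn (s := Set.Icc m q)
    have h := intermediate_value_Icc' hmq.le hc
    rw [klReal_self] at h
    obtain ⟨z, ⟨hz1, hz2⟩, hzy⟩ := h ⟨hy.le, hmy.le⟩
    have hzy : klReal z q = y := hzy
    have hzm : m ≠ z := by rintro rfl; linarith
    rcases hz2.lt_or_eq with hz2 | rfl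
    · exact ⟨z, lt_of_le_of_lt hm (lt_of_le_of_ne hz1 hzm), hz2, hzy⟩
    · rw [klReal_self] at hzy
      exact absurd hzy hy.ne


/-! ### The upper confidence index -/

lemma natCast_mul_klBer {q : ℝ} (s : ℕ) (m : ℝ) (h0 : 0 < q) (h1 : q < 1) :
    (s : ℝ≥0∞) * klBer m q = ENNReal.ofReal (s * klReal m q) := by
  rw [klBer_eq h0 h1, ENNReal.ofReal_mul (Nat.cast_nonneg s), ENNReal.ofReal_natCast]

lemma klBer_self (m : ℝ) : klBer m m = 0 := by
  unfold klBer
  rw [if_neg (by tauto)]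
  have := klReal_self m
  unfold klReal at this
  rw [this, ENNReal.ofReal_zero]

lemma klIndex_bddAbove (s : ℕ) (m : ℝ) (t : ℕ) :
    BddAbove {q : ℝ | q ∈ Set.Icc m 1 ∧
      (s : ℝ≥0∞) * klBer m q ≤ ENNReal.ofReal (Real.log t + 3 * Real.log (Real.log t))} :=
  ⟨1, fun _ h => h.1.2⟩

lemma le_klIndex_self (s : ℕ) {m : ℝ} (hm : m ≤ 1) (t : ℕ) : m ≤ klIndex s m t :=
  le_csSup (klIndex_bddAbove s m t) ⟨⟨le_rfl, hm⟩, by simp [klBer_self]⟩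

lemma le_klIndex {s t : ℕ} {m q : ℝ} (hmq : m ≤ q) (hq0 : 0 < q) (hq1 : q < 1)
    (h : s * klReal m q ≤ level t) : q ≤ klIndex s m t := by
  refine le_csSup (klIndex_bddAbove s m t) ⟨⟨hmq, hq1.le⟩, ?_⟩
  rw [natCast_mul_klBer s m hq0 hq1]
  exact ENNReal.ofReal_le_ofReal h

lemma klIndex_zero {m : ℝ} (hm : m ≤ 1) (t : ℕ) : 1 ≤ klIndex 0 m t :=
  le_csSup (klIndex_bddAbove 0 m t) ⟨⟨hm, le_rfl⟩, by simp⟩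

/-- If the constraint failed at `q`, it would fail by continuity at some `r < q` and by monotonicity
at all points above `r`, so the supremum would be at most `r`. -/
lemma mul_klReal_le_of_le_klIndex {s t : ℕ} {m q : ℝ} (ht : 0 ≤ level t) (hm : 0 ≤ m) (hmq : m < q)
    (hq1 : q < 1) (h : q ≤ klIndex s m t) : s * klReal m q ≤ level t := by
  have hq0 : 0 < q := hm.trans_lt hmq
  by_contra! hlt
  have hc : ContinuousAt (fun q => (s : ℝ) * klReal m q) q :=
    continuousAt_const.mul (continuousAt_klReal_right m hq0 hq1)
  have hev := (hc.eventually (lt_mem_nhds hlt)).and (lt_mem_nhds hmq)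
  obtain ⟨r, hr, hrq⟩ := hev.exists_lt
  obtain ⟨hr1, hr2⟩ := hrq
  have hr0 : 0 < r := hm.trans_lt hr2
  refine absurd h (not_le.2 (lt_of_le_of_lt (Real.sSup_le ?_ hr0.le) hr))
  rintro p ⟨⟨hmp, hp1⟩, hp⟩
  by_contra! hrp
  have hs : s ≠ 0 := by
    rintro rfl
    simp at hr1
    linarith
  rcases hp1.lt_or_eq with hp1 | rfl
  · rw [natCast_mul_klBer s m (hr0.trans hrp) hp1, ← level, ENNReal.ofReal_le_ofReal_iff ht] at hp
    have h2 := mul_le_mul_of_nonneg_left (klReal_mono_right hr2.le hr0 hrp.le hp1)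
      (Nat.cast_nonneg (α := ℝ) s)
    linarith
  · rw [klBer, if_pos (Or.inr ⟨rfl, (hmq.trans hq1).ne⟩), ENNReal.mul_top (by simpa using hs)] at hp
    simp at hp

/-- Handles an optimal mean equal to `1`. The supremum could reach `1` without being attained there,
so for `m < 1` the constraint has to keep `q` away from `1` by a fixed distance. -/
lemma eq_one_of_one_le_klIndex {s t : ℕ} {m : ℝ} (ht : 0 ≤ level t) (hs : s ≠ 0) (hm : 0 ≤ m)
    (hm1 : m ≤ 1) (h : 1 ≤ klIndex s m t) : m = 1 := by
  by_contra hne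
  have hlt : m < 1 := lt_of_le_of_ne hm1 hne
  have hlt' : 0 < 1 - m := sub_pos.2 hlt
  set D := (level t - m * Real.log m) / (1 - m) with hD
  -- With at least one sample the constraint gives `log ((1 - m) / (1 - p)) ≤ D`, that is, `p ≤ 1 -
  -- κ`.
  set κ := (1 - m) * Real.exp (-D) with hκ
  have hκ0 : 0 < κ := by positivity
  have hD0 : 0 ≤ D := div_nonneg (by nlinarith [Real.log_nonpos hm hm1]) hlt'.le
  have hκ1 : κ ≤ 1 := by
    have : Real.exp (-D) ≤ 1 := Real.exp_le_one_iff.2 (by linarith)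
    nlinarith
  refine absurd h (not_le.2 (lt_of_le_of_lt (b := 1 - κ) (Real.sSup_le ?_ (by linarith))
    (by linarith)))
  rintro p ⟨⟨hmp, hp1⟩, hp⟩
  rcases hp1.lt_or_eq with hp1 | rfl
  · rcases (hm.trans hmp).eq_or_lt with rfl | hp0
    · linarith
    have hp1' : 0 < 1 - p := sub_pos.2 hp1
    rw [natCast_mul_klBer s m hp0 hp1, ← level, ENNReal.ofReal_le_ofReal_iff ht] at hp
    have hk := klReal_nonneg hm hm1 hp0 hp1
    have hs1 : (1 : ℝ) ≤ s := by exact_mod_cast Nat.one_le_iff_ne_zero.2 hs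
    have h1 : klReal m p ≤ level t := by nlinarith
    unfold klReal at h1
    rw [mul_log_div_eq m hp0.ne'] at h1
    have h2 : m * Real.log p ≤ 0 := mul_nonpos_of_nonneg_of_nonpos hm (Real.log_nonpos hp0.le hp1.le)
    have h3 : Real.log ((1 - m) / (1 - p)) ≤ D := by
      rw [hD, le_div_iff₀ hlt']
      linarith
    rw [Real.log_le_iff_le_exp (by positivity), div_le_iff₀ hp1'] at h3
    have : κ ≤ 1 - p := by
      rw [hκ, Real.exp_neg, ← div_eq_mul_inv, div_le_iff₀ (Real.exp_pos D)]
      linarith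
    linarith
  · rw [klBer, if_pos (Or.inr ⟨rfl, hlt.ne⟩), ENNReal.mul_top (by simpa using hs)] at hp
    simp at hp

/-- If the index reaches `q`, then the empirical sum lies on one side of a line. -/
lemma affine_le_of_le_klIndex {s t : ℕ} {m p q : ℝ} (ht : 0 ≤ level t) (hm : 0 ≤ m) (hm1 : m ≤ 1)
    (hp : 0 < p) (hpq : p < q) (hq1 : q < 1) (h : q ≤ klIndex s m t) :
    s * (klReal p q + (m - p) * klSlope p q) ≤ level t := by
  have hq0 : 0 < q := hp.trans hpq
  have hp1 : p < 1 := hpq.trans hq1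
  have hs : (0 : ℝ) ≤ s := Nat.cast_nonneg s
  rcases lt_or_ge m q with hmq | hmq
  · refine le_trans (mul_le_mul_of_nonneg_left ?_ hs) (mul_klReal_le_of_le_klIndex ht hm hmq hq1 h)
    have := klReal_tangent m hp hp1 hq0 hq1
    have := klReal_nonneg hm hm1 hp hp1
    linarith
  -- For `m ≥ q` the tangent is nonpositive: at `q` it equals `-klReal q p`, and it does not
  -- increase.
  · refine le_trans (mul_nonpos_of_nonneg_of_nonpos hs ?_) ht
    have h1 := klReal_tangent q hp hp1 hq0 hq1
    rw [klReal_self] at h1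
    have h2 := klReal_nonneg hq0.le hq1.le hp hp1
    have h3 := klSlope_nonpos hp hpq.le hq1
    nlinarith

lemma level_pos {t : ℕ} (ht : 3 ≤ t) : 1 < Real.log t ∧ Real.log t < level t := by
  have h3 : (3 : ℝ) ≤ t := by exact_mod_cast ht
  have h1 : 1 < Real.log t := by
    rw [Real.lt_log_iff_exp_lt (by linarith)]
    linarith [Real.exp_one_lt_d9]
  refine ⟨h1, ?_⟩
  have := Real.log_pos h1
  unfold level
  linarith

lemma level_mono {m n : ℕ} (hm : 3 ≤ m) (hmn : m ≤ n) : level m ≤ level n := by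
  have h0 : (0 : ℝ) < m := by exact_mod_cast (by omega : 0 < m)
  have h1 : Real.log m ≤ Real.log n := Real.log_le_log h0 (by exact_mod_cast hmn)
  have h2 : Real.log (Real.log m) ≤ Real.log (Real.log n) :=
    Real.log_le_log (by linarith [(level_pos hm).1]) h1
  unfold level
  linarith

/-! ### Adaptively revealed samples and predictable weights -/

/-- A sequence of steps; in some of them a sample is revealed. -/
abbrev StepSeq : Type := ℕ → Bool × ℝ

/-- In each step of the random sequence `H` either nothing happens or a fresh copy of the `[0, 1]`-valued
random variable `Y` is revealed; the past decides which. -/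
structure IsSampled {Ω : Type*} [MeasurableSpace Ω] (P : Measure Ω) (H : Ω → StepSeq) (Y : Ω → ℝ) :
    Prop where
  measurable_seq : Measurable H
  measurable_sample : Measurable Y
  seq_mem : ∀ᵐ ω ∂P, ∀ k, (H ω k).2 ∈ Set.Icc (0 : ℝ) 1
  sample_mem : ∀ᵐ ω ∂P, Y ω ∈ Set.Icc (0 : ℝ) 1
  integral_step : ∀ (k : ℕ) (G : StepSeq → ℝ), Measurable G →
    (∀ h h' : StepSeq, (∀ j < k, h j = h' j) → G h = G h') → ∀ ψ : ℝ → ℝ, Measurable ψ →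
    ∫ ω, (if (H ω k).1 then G (H ω) * ψ (H ω k).2 else 0) ∂P =
      (∫ ω, (if (H ω k).1 then G (H ω) else 0) ∂P) * ∫ ω, ψ (Y ω) ∂P

/-- `a h k` is a locally bounded function of the first `k` steps. -/
structure IsPredictable (a : StepSeq → ℕ → ℝ) : Prop where
  meas : ∀ k, Measurable fun h => a h k
  congr : ∀ k (h h' : StepSeq), (∀ j < k, h j = h' j) → a h k = a h' k
  bdd : ∀ k, ∃ C, ∀ h : StepSeq, (∀ j, (h j).2 ∈ Set.Icc (0 : ℝ) 1) → |a h k| ≤ C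

/-- The function `φ` is measurable, and bounded by `B` on `[0, 1]`. -/
structure IsBddFun (φ : ℝ → ℝ) (B : ℝ) : Prop where
  meas : Measurable φ
  bdd : ∀ y ∈ Set.Icc (0 : ℝ) 1, |φ y| ≤ B

/-- The contribution of a step with weight `a`. -/
noncomputable def gate (a : StepSeq → ℕ → ℝ) (φ : ℝ → ℝ) (h : StepSeq) (k : ℕ) : ℝ :=
  if (h k).1 then a h k * φ (h k).2 else 0

/-- The sum of the contributions of the first `k` steps. -/
noncomputable def gateSum (a : StepSeq → ℕ → ℝ) (φ : ℝ → ℝ) (h : StepSeq) (k : ℕ) : ℝ :=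
  ∑ j ∈ Finset.range k, gate a φ h j

lemma gateSum_succ (a : StepSeq → ℕ → ℝ) (φ : ℝ → ℝ) (h : StepSeq) (k : ℕ) :
    gateSum a φ h (k + 1) = gateSum a φ h k + gate a φ h k :=
  Finset.sum_range_succ _ _

lemma gateSum_zero (a : StepSeq → ℕ → ℝ) (φ : ℝ → ℝ) (h : StepSeq) : gateSum a φ h 0 = 0 := rfl

namespace IsPredictable

lemma const (c : ℝ) : IsPredictable fun _ _ => c :=
  ⟨fun _ => measurable_const, fun _ _ _ _ => rfl, fun _ => ⟨|c|, fun _ _ => le_rfl⟩⟩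

variable {a b : StepSeq → ℕ → ℝ}

lemma add (ha : IsPredictable a) (hb : IsPredictable b) :
    IsPredictable fun h k => a h k + b h k := by
  refine ⟨fun k => (ha.meas k).add (hb.meas k), fun k h h' e => ?_, fun k => ?_⟩
  · rw [ha.congr k h h' e, hb.congr k h h' e]
  · obtain ⟨A, hA⟩ := ha.bdd k
    obtain ⟨B, hB⟩ := hb.bdd k
    exact ⟨A + B, fun h hh => (abs_add_le _ _).trans (add_le_add (hA h hh) (hB h hh))⟩

lemma mul (ha : IsPredictable a) (hb : IsPredictable b) :
    IsPredictable fun h k => a h k * b h k := by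
  refine ⟨fun k => (ha.meas k).mul (hb.meas k), fun k h h' e => ?_, fun k => ?_⟩
  · rw [ha.congr k h h' e, hb.congr k h h' e]
  · obtain ⟨A, hA⟩ := ha.bdd k
    obtain ⟨B, hB⟩ := hb.bdd k
    refine ⟨A * B, fun h hh => ?_⟩
    rw [abs_mul]
    exact mul_le_mul (hA h hh) (hB h hh) (abs_nonneg _) ((abs_nonneg _).trans (hA h hh))

lemma exp (ha : IsPredictable a) : IsPredictable fun h k => Real.exp (a h k) := by
  refine ⟨fun k => (ha.meas k).exp, fun k h h' e => ?_, fun k => ?_⟩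
  · rw [ha.congr k h h' e]
  · obtain ⟨A, hA⟩ := ha.bdd k
    refine ⟨Real.exp A, fun h hh => ?_⟩
    rw [abs_of_pos (Real.exp_pos _)]
    exact Real.exp_le_exp.2 ((le_abs_self _).trans (hA h hh))

lemma measurable_gate (ha : IsPredictable a) {φ : ℝ → ℝ} (hφ : Measurable φ) (k : ℕ) :
    Measurable fun h => gate a φ h k := by
  have h1 : Measurable fun h : StepSeq => h k := measurable_pi_apply k
  refine Measurable.ite ?_ ((ha.meas k).mul (hφ.comp h1.snd)) measurable_const
  exact h1.fst (measurableSet_singleton true)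

lemma gate_bdd (ha : IsPredictable a) {φ : ℝ → ℝ} {B : ℝ} (hφ : IsBddFun φ B) (k : ℕ) :
    ∃ C, ∀ h : StepSeq, (∀ j, (h j).2 ∈ Set.Icc (0 : ℝ) 1) → |gate a φ h k| ≤ C := by
  obtain ⟨A, hA⟩ := ha.bdd k
  refine ⟨A * B, fun h hh => ?_⟩
  have h0 := (abs_nonneg _).trans (hA h hh)
  have h1 := hφ.bdd _ (hh k)
  unfold gate
  split_ifs
  · rw [abs_mul]
    exact mul_le_mul (hA h hh) h1 (abs_nonneg _) h0
  · rw [abs_zero]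
    exact mul_nonneg h0 ((abs_nonneg _).trans h1)

lemma gateSum (ha : IsPredictable a) {φ : ℝ → ℝ} {B : ℝ} (hφ : IsBddFun φ B) :
    IsPredictable (gateSum a φ) := by
  refine ⟨fun k => ?_, fun k h h' e => ?_, fun k => ?_⟩
  · exact Finset.measurable_fun_sum _ fun j _ => ha.measurable_gate hφ.meas j
  · refine Finset.sum_congr rfl fun j hj => ?_
    have hj := Finset.mem_range.1 hj
    unfold gate
    rw [e j hj, ha.congr j h h' fun i hi => e i (hi.trans hj)]
  · choose C hC using ha.gate_bdd hφ
    exact ⟨∑ j ∈ Finset.range k, C j, fun h hh =>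
      (Finset.abs_sum_le_sum_abs _ _).trans (Finset.sum_le_sum fun j _ => hC j h hh)⟩

/-- The indicator of the event that a predictable process has never exceeded `L`. -/
lemma indicator_below (ha : IsPredictable a) (L : ℝ) :
    IsPredictable fun h k => {h | ∀ j ≤ k, a h j ≤ L}.indicator (fun _ => (1 : ℝ)) h := by
  refine ⟨fun k => measurable_const.indicator ?_, fun k h h' e => ?_, fun k => ⟨1, fun h _ => ?_⟩⟩
  · simp only [Set.ofPred_forall]
    exact MeasurableSet.iInter fun j => MeasurableSet.iInter fun _ =>
      measurableSet_le (ha.meas j) measurable_const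
  · have : h ∈ {h | ∀ j ≤ k, a h j ≤ L} ↔ h' ∈ {h | ∀ j ≤ k, a h j ≤ L} := by
      simp only [Set.mem_ofPred_eq]
      refine forall₂_congr fun j hj => ?_
      rw [ha.congr j h h' fun i hi => e i (hi.trans_le hj)]
    by_cases hm : h ∈ {h | ∀ j ≤ k, a h j ≤ L}
    · rw [Set.indicator_of_mem hm, Set.indicator_of_mem (this.1 hm)]
    · rw [Set.indicator_of_notMem hm, Set.indicator_of_notMem (mt this.2 hm)]
  · unfold Set.indicator
    split_ifs <;> simp

end IsPredictable

lemma isBddFun_const (c : ℝ) : IsBddFun (fun _ => c) |c| := ⟨measurable_const, fun _ _ => le_rfl⟩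

lemma IsBddFun.exp {φ : ℝ → ℝ} {B : ℝ} (hφ : IsBddFun φ B) (θ : ℝ) :
    IsBddFun (fun y => Real.exp (θ * φ y)) (Real.exp (|θ| * B)) := by
  refine ⟨(hφ.meas.const_mul θ).exp, fun y hy => ?_⟩
  rw [abs_of_pos (Real.exp_pos _)]
  refine Real.exp_le_exp.2 ((le_abs_self _).trans ?_)
  rw [abs_mul]
  exact mul_le_mul_of_nonneg_left (hφ.bdd y hy) (abs_nonneg _)

lemma IsSampled.integral_gate {Ω : Type*} [MeasurableSpace Ω] {P : Measure Ω} {H : Ω → StepSeq}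
    {Y : Ω → ℝ} {a : StepSeq → ℕ → ℝ} {φ : ℝ → ℝ} (hH : IsSampled P H Y) (ha : IsPredictable a)
    (hφ : Measurable φ) (k : ℕ) :
    ∫ ω, gate a φ (H ω) k ∂P = (∫ ω, gate a (fun _ => 1) (H ω) k ∂P) * ∫ ω, φ (Y ω) ∂P := by
  have := hH.integral_step k (fun h => a h k) (ha.meas k) (ha.congr k) φ hφ
  simpa only [gate, mul_one] using this

lemma integral_add_sub {Ω : Type*} [MeasurableSpace Ω] {P : Measure Ω} {f g h : Ω → ℝ}
    (hf : Integrable f P) (hg : Integrable g P) (hh : Integrable h P) :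
    ∫ ω, (f ω + (g ω - h ω)) ∂P = ∫ ω, f ω ∂P + (∫ ω, g ω ∂P - ∫ ω, h ω ∂P) := by
  rw [← integral_sub hg hh]
  exact integral_add hf (hg.sub hh)

namespace IsSampled

variable {Ω : Type*} [MeasurableSpace Ω] {P : Measure Ω} [IsProbabilityMeasure P] {H : Ω → StepSeq}
  {Y : Ω → ℝ} {a : StepSeq → ℕ → ℝ} {φ : ℝ → ℝ} {B : ℝ}

lemma integrable_predictable (hH : IsSampled P H Y) (ha : IsPredictable a) (k : ℕ) :
    Integrable (fun ω => a (H ω) k) P := by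
  obtain ⟨C, hC⟩ := ha.bdd k
  refine Integrable.of_bound ((ha.meas k).comp hH.measurable_seq).aestronglyMeasurable C ?_
  filter_upwards [hH.seq_mem] with ω hω
  exact hC _ hω

lemma integrable_gate (hH : IsSampled P H Y) (ha : IsPredictable a) (hφ : IsBddFun φ B) (k : ℕ) :
    Integrable (fun ω => gate a φ (H ω) k) P := by
  obtain ⟨C, hC⟩ := ha.gate_bdd hφ k
  refine Integrable.of_bound
    ((ha.measurable_gate hφ.meas k).comp hH.measurable_seq).aestronglyMeasurable C ?_
  filter_upwards [hH.seq_mem] with ω hω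
  exact hC _ hω

lemma integrable_sample (hH : IsSampled P H Y) (hφ : IsBddFun φ B) :
    Integrable (fun ω => φ (Y ω)) P := by
  refine Integrable.of_bound (hφ.meas.comp hH.measurable_sample).aestronglyMeasurable B ?_
  filter_upwards [hH.sample_mem] with ω hω
  exact hφ.bdd _ hω

/-- Supermartingale argument: a revealed sample multiplies the conditional expectation by `E[exp (φ
Y)] ≤ 1`, and a step without a sample changes nothing. -/
lemma integral_exp_gateSum_le_one (hH : IsSampled P H Y) (hφ : IsBddFun φ B)
    (h1 : ∫ ω, Real.exp (φ (Y ω)) ∂P ≤ 1) (k : ℕ) :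
    ∫ ω, Real.exp (gateSum (fun _ _ => 1) φ (H ω) k) ∂P ≤ 1 := by
  have hE : IsPredictable fun h k => Real.exp (gateSum (fun _ _ => 1) φ h k) :=
    ((IsPredictable.const 1).gateSum hφ).exp
  have hexp : IsBddFun (fun y => Real.exp (φ y)) (Real.exp B) := by
    simpa using hφ.exp 1
  induction k with
  | zero => simp [gateSum_zero]
  | succ k ih =>
    have hstep : ∀ h : StepSeq, Real.exp (gateSum (fun _ _ => 1) φ h (k + 1)) =
        Real.exp (gateSum (fun _ _ => 1) φ h k) +
        (gate (fun h k => Real.exp (gateSum (fun _ _ => 1) φ h k)) (fun y => Real.exp (φ y)) h k -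
        gate (fun h k => Real.exp (gateSum (fun _ _ => 1) φ h k)) (fun _ => 1) h k) := by
      intro h
      rw [gateSum_succ, Real.exp_add]
      simp only [gate]
      split_ifs <;> simp
    simp_rw [hstep]
    have i1 := hH.integrable_gate hE hexp k
    have i2 := hH.integrable_gate hE (isBddFun_const 1) k
    rw [integral_add_sub (hH.integrable_predictable hE k) i1 i2,
      hH.integral_gate hE hexp.meas k]
    have h0 : 0 ≤ ∫ ω, gate (fun h k => Real.exp (gateSum (fun _ _ => 1) φ h k)) (fun _ => 1)
        (H ω) k ∂P := by
      refine integral_nonneg fun ω => ?_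
      simp only [gate]
      split_ifs <;> simp [Real.exp_nonneg]
    nlinarith

/-- A sufficiently small exponential tilt of a bounded variable with positive mean is contracting. -/
lemma integral_exp_neg_le (hH : IsSampled P H Y) (hφ : IsBddFun φ B) {g : ℝ} (hg : 0 < g)
    (hm : ∫ ω, φ (Y ω) ∂P = g) :
    g ≤ B ∧ ∫ ω, Real.exp (-(g / (2 * B ^ 2)) * φ (Y ω)) ∂P ≤ 1 - g ^ 2 / (4 * B ^ 2) := by
  have hi := hH.integrable_sample hφ
  have hgB : g ≤ B := by
    rw [← hm]
    have : ∫ ω, φ (Y ω) ∂P ≤ ∫ _, B ∂P := by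
      refine integral_mono_ae hi (integrable_const B) ?_
      filter_upwards [hH.sample_mem] with ω hω
      exact (le_abs_self _).trans (hφ.bdd _ hω)
    simpa using this
  have hB : 0 < B := hg.trans_le hgB
  refine ⟨hgB, ?_⟩
  -- The minimizer of `1 - θ g + θ² B²`, which bounds the expectation because `exp x ≤ 1 + x + x²`
  -- for `|x| ≤ 1`.
  set θ := g / (2 * B ^ 2) with hθ
  have hθ0 : 0 < θ := by positivity
  have hθB : θ * B ≤ 1 := by
    rw [hθ, div_mul_eq_mul_div, div_le_one (by positivity)]
    nlinarith
  have h1 : ∫ ω, Real.exp (-θ * φ (Y ω)) ∂P ≤ ∫ ω, ((1 + θ ^ 2 * B ^ 2) - θ * φ (Y ω)) ∂P := by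
    refine integral_mono_ae (hH.integrable_sample (hφ.exp (-θ)))
      ((integrable_const _).sub (hi.const_mul θ)) ?_
    filter_upwards [hH.sample_mem] with ω hω
    have hb := hφ.bdd _ hω
    have h2 : |-θ * φ (Y ω)| ≤ θ * B := by
      rw [abs_mul, abs_neg, abs_of_pos hθ0]
      exact mul_le_mul_of_nonneg_left hb hθ0.le
    have h3 := (abs_le.1 (Real.abs_exp_sub_one_sub_id_le (h2.trans hθB))).2
    have h4 : (-θ * φ (Y ω)) ^ 2 ≤ (θ * B) ^ 2 := by
      rw [← sq_abs]
      exact pow_le_pow_left₀ (abs_nonneg _) h2 2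
    nlinarith
  refine h1.trans (le_of_eq ?_)
  rw [integral_sub (integrable_const _) (hi.const_mul θ), integral_const_mul, hm]
  simp only [integral_const, probReal_univ, smul_eq_mul, one_mul]
  rw [hθ]
  field_simp
  ring

end IsSampled

/-! ### Last passage of a random walk with positive drift -/

/-- The additive constant in the bound on the expected last passage time of a random walk with
drift `g` and increments bounded by `B`. -/
noncomputable def passConst (g B : ℝ) : ℝ := B / g + 1 / (g ^ 2 / (4 * B ^ 2)) ^ 2

/-- The walk with increments `φ` at the revealed samples, as long as it stays below `L`: the weight of
the steps before the first passage. -/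
noncomputable def below (φ : ℝ → ℝ) (L : ℝ) (h : StepSeq) (k : ℕ) : ℝ :=
  {h | ∀ j ≤ k, gateSum (fun _ _ => 1) φ h j ≤ L}.indicator (fun _ => (1 : ℝ)) h

/-- The weight of the steps after the first passage. -/
noncomputable def above (φ : ℝ → ℝ) (L : ℝ) (h : StepSeq) (k : ℕ) : ℝ := 1 + -1 * below φ L h k

/-- An exponential weight bounding the number of samples between the first and the last passage. -/
noncomputable def returnWeight (φ : ℝ → ℝ) (L θ : ℝ) (h : StepSeq) (k : ℕ) : ℝ :=
  above φ L h k * ((gateSum (above φ L) (fun _ => 1) h k + 1) *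
    Real.exp (-θ * gateSum (above φ L) φ h k))

section Passage

variable {φ : ℝ → ℝ} {B : ℝ} {L θ : ℝ}

lemma below_cases (φ : ℝ → ℝ) (L : ℝ) (h : StepSeq) (k : ℕ) :
    (below φ L h k = 1 ∧ above φ L h k = 0 ∧ ∀ j ≤ k, gateSum (fun _ _ => 1) φ h j ≤ L) ∨
    (below φ L h k = 0 ∧ above φ L h k = 1 ∧ ¬ ∀ j ≤ k, gateSum (fun _ _ => 1) φ h j ≤ L) := by
  unfold above below
  by_cases hm : ∀ j ≤ k, gateSum (fun _ _ => 1) φ h j ≤ L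
  · left
    rw [Set.indicator_of_mem (by exact hm)]
    exact ⟨rfl, by norm_num, hm⟩
  · right
    rw [Set.indicator_of_notMem (by exact hm)]
    exact ⟨rfl, by norm_num, hm⟩

lemma isPredictable_below (hφ : IsBddFun φ B) (L : ℝ) : IsPredictable (below φ L) :=
  ((IsPredictable.const 1).gateSum hφ).indicator_below L

lemma isPredictable_above (hφ : IsBddFun φ B) (L : ℝ) : IsPredictable (above φ L) :=
  (IsPredictable.const 1).add ((IsPredictable.const (-1)).mul (isPredictable_below hφ L))

lemma gateSum_below_add_above (φ ψ : ℝ → ℝ) (L : ℝ) (h : StepSeq) (k : ℕ) :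
    gateSum (fun _ _ => 1) ψ h k = gateSum (below φ L) ψ h k + gateSum (above φ L) ψ h k := by
  unfold gateSum
  rw [← Finset.sum_add_distrib]
  refine Finset.sum_congr rfl fun j _ => ?_
  unfold gate above
  split_ifs <;> ring

lemma gate_one_nonneg {a : StepSeq → ℕ → ℝ} {ψ : ℝ → ℝ} {h : StepSeq} {k : ℕ} (ha : 0 ≤ a h k)
    (hψ : ∀ y, 0 ≤ ψ y) : 0 ≤ gate a ψ h k := by
  unfold gate
  split_ifs
  exacts [mul_nonneg ha (hψ _), le_rfl]

lemma gateSum_mono {a : StepSeq → ℕ → ℝ} {ψ : ℝ → ℝ} {h : StepSeq} (ha : ∀ k, 0 ≤ a h k)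
    (hψ : ∀ y, 0 ≤ ψ y) : Monotone (gateSum a ψ h) :=
  monotone_nat_of_le_succ fun k => by
    rw [gateSum_succ]
    exact le_add_of_nonneg_right (gate_one_nonneg (ha k) hψ)

lemma gateSum_nonneg {a : StepSeq → ℕ → ℝ} {ψ : ℝ → ℝ} {h : StepSeq} (ha : ∀ k, 0 ≤ a h k)
    (hψ : ∀ y, 0 ≤ ψ y) (k : ℕ) : 0 ≤ gateSum a ψ h k :=
  gateSum_mono ha hψ (Nat.zero_le k)

lemma below_nonneg (φ : ℝ → ℝ) (L : ℝ) (h : StepSeq) (k : ℕ) : 0 ≤ below φ L h k := by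
  rcases below_cases φ L h k with h | h <;> simp [h.1]

lemma above_nonneg (φ : ℝ → ℝ) (L : ℝ) (h : StepSeq) (k : ℕ) : 0 ≤ above φ L h k := by
  rcases below_cases φ L h k with h | h <;> simp [h.2.1]

lemma returnWeight_nonneg (φ : ℝ → ℝ) (L θ : ℝ) (h : StepSeq) (k : ℕ) :
    0 ≤ returnWeight φ L θ h k := by
  have := gateSum_nonneg (above_nonneg φ L h) (fun _ => zero_le_one (α := ℝ)) k
  exact mul_nonneg (above_nonneg _ _ _ _) (mul_nonneg (by linarith) (Real.exp_nonneg _))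

lemma isPredictable_returnWeight (hφ : IsBddFun φ B) (L θ : ℝ) :
    IsPredictable (returnWeight φ L θ) :=
  (isPredictable_above hφ L).mul
    ((((isPredictable_above hφ L).gateSum (isBddFun_const 1)).add (IsPredictable.const 1)).mul
      ((IsPredictable.const (-θ)).mul ((isPredictable_above hφ L).gateSum hφ)).exp)

/-- While the walk is below `L` the stopped walk coincides with it; afterwards it has passed `L`, by at
most the bound on the increments. -/
lemma gateSum_below_dichotomy (hφ : IsBddFun φ B) (hB : 0 ≤ B) (hL : 0 ≤ L) {h : StepSeq}
    (hh : ∀ j, (h j).2 ∈ Set.Icc (0 : ℝ) 1) (k : ℕ) :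
    ((∀ j ≤ k, gateSum (fun _ _ => 1) φ h j ≤ L) ∧
      (∀ ψ, gateSum (above φ L) ψ h k = 0)) ∨
    ((¬ ∀ j ≤ k, gateSum (fun _ _ => 1) φ h j ≤ L) ∧
      L < gateSum (below φ L) φ h k ∧ gateSum (below φ L) φ h k ≤ L + B) := by
  induction k with
  | zero => exact Or.inl ⟨fun j hj => by rw [Nat.le_zero.1 hj, gateSum_zero]; exact hL,
      fun ψ => gateSum_zero _ _ _⟩
  | succ k ih =>
    rcases ih with ⟨h1, h2⟩ | ⟨h1, h2, h3⟩
    · have hab : ∀ ψ, gateSum (above φ L) ψ h (k + 1) = 0 := by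
        intro ψ
        rw [gateSum_succ, h2, zero_add, gate]
        rcases below_cases φ L h k with hc | hc
        · rw [hc.2.1]; simp
        · exact absurd h1 hc.2.2
      by_cases hle : gateSum (fun _ _ => 1) φ h (k + 1) ≤ L
      · refine Or.inl ⟨fun j hj => ?_, hab⟩
        rcases Nat.le_succ_iff.1 hj with hj | rfl
        exacts [h1 j hj, hle]
      · have e := gateSum_below_add_above φ φ L h (k + 1)
        rw [hab, add_zero] at e
        refine Or.inr ⟨fun hc => hle (hc _ le_rfl), by rw [← e]; exact not_le.1 hle, ?_⟩
        rw [← e, gateSum_succ]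
        have hk := h1 k le_rfl
        have : gate (fun _ _ => 1) φ h k ≤ B := by
          unfold gate
          split_ifs
          · rw [one_mul]
            exact (le_abs_self _).trans (hφ.bdd _ (hh k))
          · exact hB
        linarith
    · have hb : gateSum (below φ L) φ h (k + 1) = gateSum (below φ L) φ h k := by
        rw [gateSum_succ, gate]
        rcases below_cases φ L h k with hc | hc
        · exact absurd hc.2.2 h1
        · rw [hc.1]; simp
      rw [hb]
      exact Or.inr ⟨fun hc => h1 fun j hj => hc j (hj.trans (Nat.le_succ k)), h2, h3⟩

/-- The summand of the latest sample after the first passage already equals the left-hand side, and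
the other summands are nonnegative. -/
lemma gateSum_above_le_returnSum (φ : ℝ → ℝ) (L θ : ℝ) (h : StepSeq) (k : ℕ) :
    gateSum (above φ L) (fun _ => 1) h k * Real.exp (-θ * gateSum (above φ L) φ h k) ≤
      gateSum (returnWeight φ L θ) (fun y => Real.exp (-θ * φ y)) h k := by
  induction k with
  | zero => simp [gateSum_zero]
  | succ k ih =>
    have hU := gateSum_nonneg (returnWeight_nonneg φ L θ h)
      (fun y => Real.exp_nonneg (-θ * φ y)) k
    simp only [gateSum_succ]
    simp only [gate]
    split_ifs with hk
    · rcases below_cases φ L h k with hc | hc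
      · simp only [returnWeight, hc.2.1, zero_mul, add_zero]
        exact ih
      · simp only [returnWeight, hc.2.1, one_mul]
        rw [mul_add, Real.exp_add, ← mul_assoc]
        linarith
    · simpa using ih

/-- The number of samples revealed while the walk is at most `L`. -/
lemma gateSum_one_le_of_le (hφ : IsBddFun φ B) (hB : 0 ≤ B) (hL : 0 ≤ L) (hθ : 0 ≤ θ) {h : StepSeq}
    (hh : ∀ j, (h j).2 ∈ Set.Icc (0 : ℝ) 1) {k N : ℕ} (hkN : k ≤ N)
    (hk : gateSum (fun _ _ => 1) φ h k ≤ L) :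
    gateSum (fun _ _ => 1) (fun _ => 1) h k ≤ gateSum (below φ L) (fun _ => 1) h N +
      gateSum (returnWeight φ L θ) (fun y => Real.exp (-θ * φ y)) h N := by
  have m1 := gateSum_mono (below_nonneg φ L h) (fun _ => zero_le_one (α := ℝ)) hkN
  have m2 := gateSum_mono (returnWeight_nonneg φ L θ h) (fun y => Real.exp_nonneg (-θ * φ y)) hkN
  have h0 := gateSum_nonneg (returnWeight_nonneg φ L θ h) (fun y => Real.exp_nonneg (-θ * φ y)) k
  rw [gateSum_below_add_above φ]
  rcases gateSum_below_dichotomy hφ hB hL hh k with ⟨-, h2⟩ | ⟨-, h2, -⟩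
  · rw [h2]
    linarith
  · have e := gateSum_below_add_above φ φ L h k
    have h3 := gateSum_above_le_returnSum φ L θ h k
    -- The part of the walk before the first passage exceeds `L`, the whole walk does not, so the
    -- part afterwards is negative.
    have h4 : 1 ≤ Real.exp (-θ * gateSum (above φ L) φ h k) := by
      refine Real.one_le_exp ?_
      nlinarith
    have h5 := gateSum_nonneg (above_nonneg φ L h) (fun _ => zero_le_one (α := ℝ)) k
    nlinarith

end Passage

namespace IsSampled

variable {Ω : Type*} [MeasurableSpace Ω] {P : Measure Ω} [IsProbabilityMeasure P] {H : Ω → StepSeq}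
  {Y : Ω → ℝ} {a : StepSeq → ℕ → ℝ} {φ : ℝ → ℝ} {B g L : ℝ}

/-- Wald's identity for predictable weights. -/
lemma integral_gateSum (hH : IsSampled P H Y) (ha : IsPredictable a) (hφ : IsBddFun φ B) (k : ℕ) :
    ∫ ω, gateSum a φ (H ω) k ∂P =
      (∫ ω, gateSum a (fun _ => 1) (H ω) k ∂P) * ∫ ω, φ (Y ω) ∂P := by
  unfold gateSum
  rw [integral_finsetSum _ fun j _ => hH.integrable_gate ha hφ j,
    integral_finsetSum _ fun j _ => hH.integrable_gate ha (isBddFun_const 1) j, Finset.sum_mul]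
  exact Finset.sum_congr rfl fun j _ => hH.integral_gate ha hφ.meas j

/-- Wald's bound on the number of samples before the first passage above `L`. -/
lemma integral_gateSum_below_le (hH : IsSampled P H Y) (hφ : IsBddFun φ B) (hg : 0 < g)
    (hm : ∫ ω, φ (Y ω) ∂P = g) (hB : 0 ≤ B) (hL : 0 ≤ L) (N : ℕ) :
    ∫ ω, gateSum (below φ L) (fun _ => 1) (H ω) N ∂P ≤ (L + B) / g := by
  have hb := isPredictable_below hφ L
  have h1 := hH.integral_gateSum hb hφ N
  rw [hm] at h1
  rw [le_div_iff₀ hg, ← h1]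
  have h2 : ∫ ω, gateSum (below φ L) φ (H ω) N ∂P ≤ ∫ _, (L + B) ∂P := by
    refine integral_mono_ae (hH.integrable_predictable (hb.gateSum hφ) N) (integrable_const _) ?_
    filter_upwards [hH.seq_mem] with ω hω
    rcases gateSum_below_dichotomy hφ hB hL hω N with ⟨h3, h4⟩ | ⟨-, -, h3⟩
    · have e := gateSum_below_add_above φ φ L (H ω) N
      rw [h4, add_zero] at e
      rw [← e]
      exact (h3 N le_rfl).trans (by linarith)
    · exact h3
  simpa using h2

/-- The `m`-th sample after the first passage contributes `m` times the exponential of `m` tilted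
increments. This has expectation at most `m (1 - κ)^m`, and these numbers sum to at most `1 / κ²`.
As the samples arrive adaptively, the series is carried by a potential that does not increase in
expectation. -/
lemma integral_returnSum_le (hH : IsSampled P H Y) (hφ : IsBddFun φ B) (hg : 0 < g)
    (hm : ∫ ω, φ (Y ω) ∂P = g) (L : ℝ) (N : ℕ) :
    ∫ ω, gateSum (returnWeight φ L (g / (2 * B ^ 2)))
      (fun y => Real.exp (-(g / (2 * B ^ 2)) * φ y)) (H ω) N ∂P ≤
      1 / (g ^ 2 / (4 * B ^ 2)) ^ 2 := by
  obtain ⟨hgB, hq⟩ := hH.integral_exp_neg_le hφ hg hm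
  have hB : 0 < B := hg.trans_le hgB
  set θ := g / (2 * B ^ 2)
  set κ := g ^ 2 / (4 * B ^ 2) with hκ
  have hκ0 : 0 < κ := by positivity
  set q := ∫ ω, Real.exp (-θ * φ (Y ω)) ∂P
  set S : StepSeq → ℕ → ℝ := gateSum (above φ L) fun _ => 1 with hS
  set E : StepSeq → ℕ → ℝ := fun h k => Real.exp (-θ * gateSum (above φ L) φ h k) with hE
  set U : StepSeq → ℕ → ℝ := gateSum (returnWeight φ L θ) fun y => Real.exp (-θ * φ y) with hU
  have pa := isPredictable_above hφ L
  have pS : IsPredictable S := pa.gateSum (isBddFun_const 1)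
  have pE : IsPredictable E := ((IsPredictable.const (-θ)).mul (pa.gateSum hφ)).exp
  have pU : IsPredictable U := (isPredictable_returnWeight hφ L θ).gateSum (hφ.exp (-θ))
  set A1 : StepSeq → ℕ → ℝ := fun h k =>
    above φ L h k * ((1 / κ ^ 2 + (1 / κ + 1) * (S h k + 1)) * E h k) with hA1
  set A2 : StepSeq → ℕ → ℝ := fun h k =>
    above φ L h k * ((1 / κ ^ 2 + 1 / κ * S h k) * E h k) with hA2
  have pA1 : IsPredictable A1 := pa.mul (((IsPredictable.const _).add
    ((IsPredictable.const _).mul (pS.add (IsPredictable.const 1)))).mul pE)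
  have pA2 : IsPredictable A2 := pa.mul (((IsPredictable.const _).add
    ((IsPredictable.const _).mul pS)).mul pE)
  -- The accumulated sum plus a bound on what is still to come: after `S` samples the future
  -- contributes at most `E ∑_{j ≥ 1} (S + j) (1 - κ)^j ≤ E (1 / κ² + S / κ)` on average. `A1` and
  -- `A2` are the coefficients of the potential gained and lost at a revealed sample.
  set V : StepSeq → ℕ → ℝ := fun h k => U h k + (1 / κ ^ 2 + 1 / κ * S h k) * E h k with hV
  have pV : IsPredictable V :=
    pU.add (((IsPredictable.const _).add ((IsPredictable.const _).mul pS)).mul pE)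
  have hS0 : ∀ h k, 0 ≤ S h k := fun h =>
    gateSum_nonneg (above_nonneg φ L h) (fun _ => zero_le_one (α := ℝ))
  have hE0 : ∀ h k, 0 ≤ E h k := fun h k => Real.exp_nonneg _
  have hstep : ∀ h k, V h (k + 1) = V h k +
      (gate A1 (fun y => Real.exp (-θ * φ y)) h k - gate A2 (fun _ => 1) h k) := by
    intro h k
    simp only [hV, hU, hS, hE, hA1, hA2, gateSum_succ]
    simp only [gate]
    split_ifs with hk
    · rcases below_cases φ L h k with hc | hc
      · simp [returnWeight, hc.2.1]
      · simp only [returnWeight, hc.2.1, one_mul]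
        rw [mul_add (-θ), Real.exp_add]
        ring
    · simp
  have hbd : ∀ k, ∫ ω, V (H ω) k ∂P ≤ 1 / κ ^ 2 := by
    intro k
    induction k with
    | zero => simp [hV, hU, hS, hE, gateSum_zero]
    | succ k ih =>
      simp_rw [hstep]
      have i1 := hH.integrable_gate pA1 (hφ.exp (-θ)) k
      have i2 := hH.integrable_gate pA2 (isBddFun_const 1) k
      have i3 := hH.integrable_gate pA1 (isBddFun_const 1) k
      rw [integral_add_sub (hH.integrable_predictable pV k) i1 i2,
        hH.integral_gate pA1 (hφ.exp (-θ)).meas k, ← integral_mul_const]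
      have : ∫ ω, gate A1 (fun _ => 1) (H ω) k * q ∂P ≤ ∫ ω, gate A2 (fun _ => 1) (H ω) k ∂P := by
        refine integral_mono (i3.mul_const q) i2 fun ω => ?_
        simp only [gate, hA1, hA2]
        split_ifs
        · have ha := above_nonneg φ L (H ω) k
          have hS' := hS0 (H ω) k
          have hE' := hE0 (H ω) k
          have key : (1 / κ ^ 2 + (1 / κ + 1) * (S (H ω) k + 1)) * q ≤
              1 / κ ^ 2 + 1 / κ * S (H ω) k := by
            have hpos : 0 ≤ 1 / κ ^ 2 + (1 / κ + 1) * (S (H ω) k + 1) := by positivity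
            refine (mul_le_mul_of_nonneg_left hq hpos).trans ?_
            have e : (1 / κ ^ 2 + (1 / κ + 1) * (S (H ω) k + 1)) * (1 - κ) =
                1 / κ ^ 2 + 1 / κ * S (H ω) k - κ * (S (H ω) k + 1) := by
              field_simp
              ring
            rw [e]
            nlinarith
          rw [mul_one, mul_one, mul_assoc, mul_right_comm]
          exact mul_le_mul_of_nonneg_left (mul_le_mul_of_nonneg_right key hE') ha
        · simp
      linarith
  refine le_trans (integral_mono (hH.integrable_predictable pU N)
    (hH.integrable_predictable pV N) fun ω => ?_) (hbd N)
  have := hS0 (H ω) N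
  have := hE0 (H ω) N
  simp only [hV]
  exact le_add_of_nonneg_right (by positivity)

/-- The number of samples revealed up to the last time at which the walk with increments `φ` is at
most `L` is, in expectation, at most `L / g` up to a constant. -/
lemma exists_lastPassage (hH : IsSampled P H Y) (hφ : IsBddFun φ B) (hg : 0 < g)
    (hm : ∫ ω, φ (Y ω) ∂P = g) (hL : 0 ≤ L) (N : ℕ) :
    ∃ R : Ω → ℝ, Integrable R P ∧ ∫ ω, R ω ∂P ≤ L / g + passConst g B ∧ (∀ ω, 0 ≤ R ω) ∧
      ∀ᵐ ω ∂P, ∀ k ≤ N, gateSum (fun _ _ => 1) φ (H ω) k ≤ L →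
        gateSum (fun _ _ => 1) (fun _ => 1) (H ω) k ≤ R ω := by
  have hB : 0 < B := hg.trans_le (hH.integral_exp_neg_le hφ hg hm).1
  set θ := g / (2 * B ^ 2) with hθ
  have i1 := hH.integrable_predictable
    ((isPredictable_below hφ L).gateSum (isBddFun_const 1)) N
  have i2 := hH.integrable_predictable
    ((isPredictable_returnWeight hφ L θ).gateSum (hφ.exp (-θ))) N
  refine ⟨_, i1.add i2, ?_, fun ω => ?_, ?_⟩
  · have e := integral_add i1 i2
    have h1 := hH.integral_gateSum_below_le hφ hg hm hB.le hL N
    have h2 := hH.integral_returnSum_le hφ hg hm L N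
    simp only [Pi.add_apply]
    rw [e, passConst]
    rw [add_div] at h1
    linarith
  · exact add_nonneg (gateSum_nonneg (below_nonneg φ L _) (fun _ => zero_le_one (α := ℝ)) N)
      (gateSum_nonneg (returnWeight_nonneg φ L θ _) (fun y => Real.exp_nonneg _) N)
  · filter_upwards [hH.seq_mem] with ω hω k hk hkL
    exact gateSum_one_le_of_le hφ hB.le hL (by positivity) hω hk hkL

end IsSampled

/-! ### Feedbacks in the order of their arrival -/

section Run

variable {K : ℕ} {S : Type*} [MeasurableSpace S] (F : Forecaster K S)
  (x : Fin K → ℕ → ℝ) (d : Fin K → ℕ → ℕ) (u : S)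

/-- The rewards `x`, with the reward of `i` in round `s` replaced by `v`. -/
def setReward (x : Fin K → ℕ → ℝ) (i : Fin K) (s : ℕ) (v : ℝ) : Fin K → ℕ → ℝ :=
  fun j t => if j = i ∧ t = s then v else x j t

/-- A reward does not influence the predictions made until it is revealed. -/
lemma run_setReward {i : Fin K} {s r : ℕ} (h : r ≤ s + d i s) (v : ℝ) {q : ℕ} (hq : q ≤ r) :
    run F (setReward x i s v) d u q = run F x d u q := by
  induction q using Nat.strong_induction_on with
  | _ q ih =>
    rw [run, run]
    congr 1
    funext p
    rw [ih p p.isLt (p.isLt.le.trans hq)]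
    unfold record
    split_ifs with hp
    · have : setReward x i s v (run F x d u p) p = x (run F x d u p) p := by
        unfold setReward
        rw [if_neg]
        rintro ⟨h1, h2⟩
        rw [h1, h2] at hp
        omega
      rw [this]
    · rfl

/-- The feedbacks for `i` listed one by one: step `k = r n + s` belongs to the play of round `s < n`
and to the end of round `r`. -/
noncomputable def stepSeq (i : Fin K) (n : ℕ) : StepSeq := fun k =>
  if run F x d u (k % n) = i ∧ k % n + d i (k % n) = k / n then (true, x i (k % n)) else (false, 0)

/-- A step `j ≤ k` with a feedback concerns a play of round `j % n ≤ j / n ≤ k / n`, and predictions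
up to round `k / n` cannot depend on a reward that is not revealed before the end of that round. -/
lemma stepSeq_setReward_fst {i : Fin K} {n k j : ℕ} (hk : k / n ≤ k % n + d i (k % n)) (v : ℝ)
    (hj : j ≤ k) :
    (run F (setReward x i (k % n) v) d u (j % n) = i ∧ j % n + d i (j % n) = j / n) ↔
      (run F x d u (j % n) = i ∧ j % n + d i (j % n) = j / n) := by
  refine and_congr_left fun h => ?_
  have : j / n ≤ k / n := Nat.div_le_div_right hj
  rw [run_setReward F x d u hk v (by omega)]

/-- An earlier step revealing the changed reward would have the same round of play, hence the same
round of arrival, and so would be step `k` itself. -/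
lemma stepSeq_setReward {i : Fin K} {n k j : ℕ} (hk : k % n + d i (k % n) = k / n) (v : ℝ)
    (hj : j < k) :
    stepSeq F (setReward x i (k % n) v) d u i n j = stepSeq F x d u i n j := by
  unfold stepSeq
  simp only [stepSeq_setReward_fst F x d u hk.ge v hj.le]
  split_ifs with h
  · have : setReward x i (k % n) v i (j % n) = x i (j % n) := by
      unfold setReward
      rw [if_neg]
      rintro ⟨-, h2⟩
      have h3 : j / n = k / n := by rw [← h.2, h2, hk]
      have := Nat.div_add_mod j n
      have := Nat.div_add_mod k n
      rw [h2, h3] at *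
      omega
    rw [this]
  · rfl

/-- A function of the first `k` steps, if step `k` reveals a feedback, does not depend on the reward
revealed in step `k`. -/
lemma ite_stepSeq_setReward (i : Fin K) (n k : ℕ) (v : ℝ) (G : StepSeq → ℝ)
    (hG : ∀ h h' : StepSeq, (∀ j < k, h j = h' j) → G h = G h') :
    (if (stepSeq F (setReward x i (k % n) v) d u i n k).1 = true then
      G (stepSeq F (setReward x i (k % n) v) d u i n) else 0) =
    if (stepSeq F x d u i n k).1 = true then G (stepSeq F x d u i n) else 0 := by
  by_cases hk : k % n + d i (k % n) = k / n
  · have h1 : (stepSeq F (setReward x i (k % n) v) d u i n k).1 = (stepSeq F x d u i n k).1 := by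
      unfold stepSeq
      simp only [stepSeq_setReward_fst F x d u hk.ge v le_rfl]
      split_ifs <;> rfl
    rw [h1, hG _ _ fun j hj => stepSeq_setReward F x d u hk v hj]
  · rw [if_neg, if_neg] <;> simp [stepSeq, hk]

lemma stepSeq_snd {i : Fin K} {n k : ℕ} (h : (stepSeq F x d u i n k).1 = true) :
    (stepSeq F x d u i n k).2 = x i (k % n) := by
  unfold stepSeq at h ⊢
  split_ifs at h ⊢
  rfl

/-- The sum over all feedbacks for `i` received by the end of the first `t` rounds. -/
lemma gateSum_stepSeq (i : Fin K) {t n : ℕ} (htn : t ≤ n) (φ : ℝ → ℝ) :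
    gateSum (fun _ _ => 1) φ (stepSeq F x d u i n) (t * n) =
      ∑ s ∈ (Finset.range t).filter (fun s => run F x d u s = i ∧ s + d i s < t), φ (x i s) := by
  have h1 : ∀ m, gateSum (fun _ _ => 1) φ (stepSeq F x d u i n) (m * n) =
      ∑ r ∈ Finset.range m, ∑ s ∈ Finset.range n,
        if run F x d u s = i ∧ s + d i s = r then φ (x i s) else 0 := by
    intro m
    induction m with
    | zero => simp [gateSum_zero]
    | succ m ih =>
      rw [Finset.sum_range_succ, ← ih, Nat.succ_mul]
      unfold gateSum
      rw [Finset.sum_range_add]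
      congr 1
      refine Finset.sum_congr rfl fun s hs => ?_
      have hs := Finset.mem_range.1 hs
      have e1 : (m * n + s) % n = s := by
        rw [add_comm, Nat.add_mul_mod_self_right, Nat.mod_eq_of_lt hs]
      have e2 : (m * n + s) / n = m := by
        rw [mul_comm, Nat.mul_add_div (by omega), Nat.div_eq_of_lt hs, add_zero]
      simp only [gate, stepSeq, e1, e2]
      split_ifs <;> simp_all
  rw [h1, Finset.sum_comm, Finset.sum_filter]
  -- Plays in rounds `s ≥ t` drop out, since their feedback arrives in round `s` at the earliest.
  rw [← Finset.sum_subset (Finset.range_subset_range.2 htn)]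
  · refine Finset.sum_congr rfl fun s _ => ?_
    by_cases hr : run F x d u s = i
    · simp [hr, Finset.sum_ite_eq]
    · simp [hr]
  · intro s _ hs
    refine Finset.sum_eq_zero fun r hr => if_neg ?_
    simp only [Finset.mem_range] at hs hr
    omega

lemma gateSum_one_stepSeq (i : Fin K) {t n : ℕ} (htn : t ≤ n) :
    gateSum (fun _ _ => 1) (fun _ => 1) (stepSeq F x d u i n) (t * n) = received F x d u i t := by
  rw [gateSum_stepSeq F x d u i htn, received]
  simp

lemma gateSum_affine_stepSeq (i : Fin K) {t n : ℕ} (htn : t ≤ n) (a b : ℝ) :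
    gateSum (fun _ _ => 1) (fun y => a * y + b) (stepSeq F x d u i n) (t * n) =
      a * (∑ s ∈ (Finset.range t).filter (fun s => run F x d u s = i ∧ s + d i s < t), x i s) +
        received F x d u i t * b := by
  rw [gateSum_stepSeq F x d u i htn, received, Finset.sum_add_distrib, ← Finset.mul_sum]
  simp

/-- What is known when the prediction of round `t` is made. -/
noncomputable def history (t : ℕ) : Fin t → Record K := fun s =>
  record t s (run F x d u s) (d (run F x d u s) s) (x (run F x d u s) s)

lemma run_eq (t : ℕ) : run F x d u t = F.predict t (history F x d u t) u := by
  rw [run]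
  rfl

lemma history_observed_iff (i : Fin K) (t : ℕ) (s : Fin t) :
    ((history F x d u t s).1 = i ∧ (history F x d u t s).2.1 = true) ↔
      (run F x d u s = i ∧ (s : ℕ) + d i s < t) := by
  unfold history record
  split_ifs with h
  · simp only [and_true]
    constructor
    · rintro rfl
      exact ⟨rfl, h⟩
    · exact fun h => h.1
  · simp only [and_false, false_iff, not_and]
    rintro rfl
    exact h

lemma sum_history (i : Fin K) (t : ℕ) (f : Record K → ℝ) :
    ∑ s ∈ Finset.univ.filter (fun s => (history F x d u t s).1 = i ∧
      (history F x d u t s).2.1 = true), f (history F x d u t s) =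
    ∑ s ∈ (Finset.range t).filter (fun s => run F x d u s = i ∧ s + d i s < t),
      f (i, true, d i s, x i s) := by
  rw [Finset.sum_filter, Finset.sum_filter, ← Fin.sum_univ_eq_sum_range (fun s =>
    if run F x d u s = i ∧ s + d i s < t then f (i, true, d i s, x i s) else 0)]
  refine Finset.sum_congr rfl fun s _ => ?_
  simp only [history_observed_iff]
  split_ifs with h
  · obtain ⟨rfl, h⟩ := h
    rw [history, record, if_pos h]
  · rfl

lemma numObserved_history (i : Fin K) (t : ℕ) :
    numObserved (history F x d u t) i = received F x d u i t := by
  have := sum_history F x d u i t fun _ => 1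
  simp only [Finset.sum_const, nsmul_eq_mul, mul_one, Nat.cast_inj] at this
  exact this

/-- The sum of the rewards of `i` received by the end of the first `t` rounds. -/
noncomputable def receivedSum (i : Fin K) (t : ℕ) : ℝ :=
  ∑ s ∈ (Finset.range t).filter (fun s => run F x d u s = i ∧ s + d i s < t), x i s

lemma empMean_history (i : Fin K) (t : ℕ) :
    empMean (history F x d u t) i = receivedSum F x d u i t / received F x d u i t := by
  rw [empMean, numObserved_history, sum_history F x d u i t fun r => r.2.2.2]
  rfl

lemma received_le (i : Fin K) (t : ℕ) : received F x d u i t ≤ t :=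
  (Finset.card_filter_le _ _).trans (Finset.card_range t).le

lemma plays_le_received_add (i : Fin K) {t n : ℕ} (ht : t < n) :
    plays F x d u i t ≤ received F x d u i t + maxMissing F x d u i n := by
  have : plays F x d u i t - received F x d u i t ≤ maxMissing F x d u i n :=
    Finset.le_sup (f := fun t => plays F x d u i t - received F x d u i t) (Finset.mem_range.2 ht)
  omega

lemma maxMissing_le (i : Fin K) (n : ℕ) : maxMissing F x d u i n ≤ n := by
  refine Finset.sup_le fun t ht => ?_
  have h1 : plays F x d u i t ≤ t := (Finset.card_filter_le _ _).trans (Finset.card_range t).le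
  have := Finset.mem_range.1 ht
  omega

lemma maxMissing_eq_zero (hd : ∀ i t, d i t = 0) (i : Fin K) (n : ℕ) :
    maxMissing F x d u i n = 0 := by
  refine Nat.le_zero.1 (Finset.sup_le fun t _ => ?_)
  have : plays F x d u i t = received F x d u i t := by
    unfold plays received
    congr 1
    refine Finset.filter_congr fun s hs => ?_
    simp [hd, Finset.mem_range.1 hs]
  simp [this]

end Run

/-! ### Measurability in the rewards, the delays and the randomization -/

section Measurability

variable {K : ℕ} {S : Type*} [MeasurableSpace S] (F : Forecaster K S)

/-- The rewards, the delays and the internal randomization. -/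
abbrev Input (K : ℕ) (S : Type*) : Type _ := (Fin K → ℕ → ℝ) × (Fin K → ℕ → ℕ) × S

lemma measurable_select {α β : Type*} [MeasurableSpace α] [MeasurableSpace β] {f : α → Fin K}
    {G : Fin K → α → β} (hf : Measurable f) (hG : ∀ i, Measurable (G i)) :
    Measurable fun a => G (f a) a :=
  (measurable_from_prod_countable_left (f := fun q : α × Fin K => G q.2 q.1) hG).comp
    (measurable_id.prodMk hf)

lemma measurable_record (t s : ℕ) :
    Measurable fun q : Fin K × ℕ × ℝ => record t s q.1 q.2.1 q.2.2 := by
  unfold record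
  refine Measurable.ite (measurableSet_lt (by fun_prop) (by fun_prop)) ?_ ?_
  · exact measurable_fst.prodMk (measurable_const.prodMk
      (measurable_snd.fst.prodMk measurable_snd.snd))
  · exact measurable_fst.prodMk measurable_const

lemma measurable_run (t : ℕ) : Measurable fun p : Input K S => run F p.1 p.2.1 p.2.2 t := by
  induction t using Nat.strong_induction_on with
  | _ t ih =>
    have : (fun p : Input K S => run F p.1 p.2.1 p.2.2 t) =
        fun p => F.predict t (history F p.1 p.2.1 p.2.2 t) p.2.2 := by
      funext p
      rw [run_eq]
    rw [this]
    refine (F.measurable_predict t).comp (Measurable.prodMk (measurable_pi_lambda _ fun s => ?_)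
      measurable_snd.snd)
    have hs := ih s s.isLt
    refine (measurable_record t s).comp (hs.prodMk (Measurable.prodMk ?_ ?_))
    · exact measurable_select hs (G := fun i (p : Input K S) => p.2.1 i s) fun i => by fun_prop
    · exact measurable_select hs (G := fun i (p : Input K S) => p.1 i s) fun i => by fun_prop

lemma measurable_stepSeq (i : Fin K) (n : ℕ) :
    Measurable fun p : Input K S => stepSeq F p.1 p.2.1 p.2.2 i n := by
  refine measurable_pi_lambda _ fun k => ?_
  unfold stepSeq
  refine Measurable.ite ?_ ?_ measurable_const
  · have h1 : Measurable fun p : Input K S => p.2.1 i (k % n) := by fun_prop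
    exact (measurable_run F (k % n) (measurableSet_singleton i)).inter
      (measurableSet_eq_fun (measurable_const.add h1) measurable_const)
  · exact measurable_const.prodMk (by fun_prop)

lemma measurable_plays (i : Fin K) (t : ℕ) :
    Measurable fun p : Input K S => plays F p.1 p.2.1 p.2.2 i t := by
  simp_rw [plays, Finset.card_filter]
  exact Finset.measurable_fun_sum _ fun s _ => Measurable.ite
    (measurable_run F s (measurableSet_singleton i)) measurable_const measurable_const

lemma measurable_received (i : Fin K) (t : ℕ) :
    Measurable fun p : Input K S => received F p.1 p.2.1 p.2.2 i t := by
  simp_rw [received, Finset.card_filter]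
  refine Finset.measurable_fun_sum _ fun s _ => Measurable.ite ?_ measurable_const measurable_const
  have h1 : Measurable fun p : Input K S => p.2.1 i s := by fun_prop
  exact (measurable_run F s (measurableSet_singleton i)).inter
      (measurableSet_lt (measurable_const.add h1) measurable_const)

lemma measurable_maxMissing (i : Fin K) (n : ℕ) :
    Measurable fun p : Input K S => maxMissing F p.1 p.2.1 p.2.2 i n := by
  unfold maxMissing
  induction Finset.range n using Finset.induction_on with
  | empty => simp
  | insert t s _ ih =>
    simp only [Finset.sup_insert]
    exact ((measurable_plays F i t).sub (measurable_received F i t)).sup ih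

lemma measurable_setReward {Ω : Type*} {m : MeasurableSpace Ω} {X : Fin K → ℕ → Ω → ℝ} {i : Fin K}
    {s : ℕ} (hX : ∀ j t, ¬(j = i ∧ t = s) → Measurable (X j t)) (v : ℝ) :
    Measurable fun ω => setReward (fun j t => X j t ω) i s v := by
  refine measurable_pi_lambda _ fun j => measurable_pi_lambda _ fun t => ?_
  unfold setReward
  split_ifs with h
  · exact measurable_const
  · exact hX j t h

end Measurability

/-! ### Revealed rewards are fresh samples -/

/-- If `A` is independent of `B`, and `(A, B)` of `D`, then `A` is independent of `(B, D)`. -/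
lemma indepFun_prodMk_of_indepFun {Ω α β γ : Type*} [MeasurableSpace Ω] [MeasurableSpace α]
    [MeasurableSpace β] [MeasurableSpace γ] {P : Measure Ω} [IsProbabilityMeasure P] {A : Ω → α}
    {B : Ω → β} {D : Ω → γ} (hA : Measurable A) (hB : Measurable B) (hD : Measurable D)
    (hAB : IndepFun A B P) (hABD : IndepFun (fun ω => (A ω, B ω)) D P) :
    IndepFun A (fun ω => (B ω, D ω)) P := by
  have hBD : IndepFun B D P := hABD.comp measurable_snd measurable_id
  rw [indepFun_iff_map_prod_eq_prod_map_map hA.aemeasurable (hB.prodMk hD).aemeasurable,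
    (indepFun_iff_map_prod_eq_prod_map_map hB.aemeasurable hD.aemeasurable).1 hBD]
  have := Measure.isProbabilityMeasure_map (μ := P) hA.aemeasurable
  have := Measure.isProbabilityMeasure_map (μ := P) hB.aemeasurable
  have := Measure.isProbabilityMeasure_map (μ := P) hD.aemeasurable
  rw [← Measure.prodAssoc_prod, ← (indepFun_iff_map_prod_eq_prod_map_map hA.aemeasurable
    hB.aemeasurable).1 hAB, ← (indepFun_iff_map_prod_eq_prod_map_map (hA.prodMk hB).aemeasurable
    hD.aemeasurable).1 hABD, Measure.map_map MeasurableEquiv.prodAssoc.measurable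
    ((hA.prodMk hB).prodMk hD)]
  rfl

namespace IsDelayedBandit

variable {K : ℕ} {Ω S : Type*} [MeasurableSpace Ω] [MeasurableSpace S] {P : Measure Ω}
  {μ : Fin K → ℝ} {X : Fin K → ℕ → Ω → ℝ} {τ : Fin K → ℕ → Ω → ℕ} {U : Ω → S}

lemma measurable_rewards (hb : IsDelayedBandit P μ X τ U) : Measurable fun ω i t => X i t ω :=
  measurable_pi_lambda _ fun i => measurable_pi_lambda _ fun t => hb.measurable_reward i t

lemma measurable_delays (hb : IsDelayedBandit P μ X τ U) :
    Measurable fun ω => ((fun i t => τ i t ω), U ω) :=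
  (measurable_pi_lambda _ fun i => measurable_pi_lambda _ fun t => hb.measurable_delay i t).prodMk
    hb.measurable_seed

lemma measurable_input (hb : IsDelayedBandit P μ X τ U) :
    Measurable fun ω => (((fun i t => X i t ω), (fun i t => τ i t ω), U ω) : Input K S) :=
  hb.measurable_rewards.prodMk hb.measurable_delays

lemma ae_mem_Icc (hb : IsDelayedBandit P μ X τ U) :
    ∀ᵐ ω ∂P, ∀ i t, X i t ω ∈ Set.Icc (0 : ℝ) 1 :=
  ae_all_iff.2 fun i => ae_all_iff.2 fun t => hb.mem_Icc i t

/-- A reward is independent of all other rewards together with the delays and the randomization. -/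
lemma indepFun_setReward [IsProbabilityMeasure P] (hb : IsDelayedBandit P μ X τ U) (i : Fin K)
    (s : ℕ) :
    IndepFun (X i s) (fun ω => ((setReward (fun i t => X i t ω) i s 0,
      (fun i t => τ i t ω), U ω) : Input K S)) P := by
  have hset : Measurable fun x : Fin K → ℕ → ℝ => setReward x i s 0 :=
    measurable_setReward (X := fun j t (x : Fin K → ℕ → ℝ) => x j t) (fun j t _ => by fun_prop) 0
  refine indepFun_prodMk_of_indepFun (hb.measurable_reward i s) (hset.comp hb.measurable_rewards)
    hb.measurable_delays ?_ ?_
  · have hd : Disjoint ({(i, s)} : Set (Fin K × ℕ)) {(i, s)}ᶜ := disjoint_compl_right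
    have hi := indep_iSup_of_disjoint
      (fun p : Fin K × ℕ => (hb.measurable_reward p.1 p.2).comap_le) hb.indep_rewards hd
    refine indep_of_indep_of_le_right (indep_of_indep_of_le_left hi ?_) ?_
    · exact le_iSup₂_of_le (i, s) rfl le_rfl
    · rw [← measurable_iff_comap_le]
      refine measurable_setReward (fun j t h => ?_) 0
      have hm : (j, t) ∈ ({(i, s)}ᶜ : Set (Fin K × ℕ)) := by simpa using h
      exact (comap_measurable (X j t)).mono (le_iSup₂_of_le (j, t) hm le_rfl) le_rfl
  · have h2 : Measurable fun x : Fin K → ℕ → ℝ => (x i s, setReward x i s 0) :=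
      Measurable.prodMk (by fun_prop) hset
    exact hb.indep_delays.comp h2 measurable_id

/-- The feedbacks for `i`, listed in the order in which they are revealed, are fresh copies of the
reward of `i`. -/
lemma isSampled [IsProbabilityMeasure P] (hb : IsDelayedBandit P μ X τ U) (F : Forecaster K S)
    (i : Fin K) (n : ℕ) :
    IsSampled P (fun ω => stepSeq F (fun i t => X i t ω) (fun i t => τ i t ω) (U ω) i n)
      (X i 0) := by
  refine ⟨(measurable_stepSeq F i n).comp hb.measurable_input, hb.measurable_reward i 0, ?_,
    hb.mem_Icc i 0, fun k G hG hGk ψ hψ => ?_⟩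
  · filter_upwards [hb.ae_mem_Icc] with ω hω k
    unfold stepSeq
    split_ifs
    · exact hω i (k % n)
    · simp
  · set Φ : Input K S → ℝ := fun p => if (stepSeq F p.1 p.2.1 p.2.2 i n k).1 = true then
      G (stepSeq F p.1 p.2.1 p.2.2 i n) else 0 with hΦ
    have hΦm : Measurable Φ := by
      have hm := measurable_stepSeq F i n
      refine Measurable.ite ?_ (hG.comp hm) measurable_const
      exact ((measurable_pi_apply k).comp hm).fst (measurableSet_singleton true)
    -- The past, on the event that step `k` reveals a feedback, can be computed with that reward
    -- erased; hence it is a function of variables independent of the reward.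
    have hinv : ∀ ω, Φ (setReward (fun i t => X i t ω) i (k % n) 0, (fun i t => τ i t ω), U ω) =
        Φ ((fun i t => X i t ω), (fun i t => τ i t ω), U ω) := fun ω =>
      ite_stepSeq_setReward F _ _ _ i n k 0 G hGk
    have hind := (hb.indepFun_setReward i (k % n)).comp hψ hΦm
    have hmeas : Measurable fun ω =>
        Φ (setReward (fun i t => X i t ω) i (k % n) 0, (fun i t => τ i t ω), U ω) := by
      simp_rw [hinv]
      exact hΦm.comp hb.measurable_input
    have he := hind.integral_fun_mul_eq_mul_integral
      (hψ.comp (hb.measurable_reward i (k % n))).aestronglyMeasurable hmeas.aestronglyMeasurable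
    simp only [Function.comp_apply, hinv] at he
    have hid : ∫ ω, ψ (X i (k % n) ω) ∂P = ∫ ω, ψ (X i 0 ω) ∂P :=
      ((hb.identDistrib i (k % n)).comp hψ).integral_eq
    rw [hid, mul_comm] at he
    rw [← he]
    refine integral_congr_ae (Filter.Eventually.of_forall fun ω => ?_)
    simp only [hΦ]
    split_ifs with h
    · rw [stepSeq_snd F _ _ _ h, mul_comm]
    · rw [mul_zero]

end IsDelayedBandit

/-! ### Affine increments, empirical means and peeling estimates -/

lemma isBddFun_affine (a b : ℝ) : IsBddFun (fun y => a * y + b) (|a| + |b|) := by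
  refine ⟨by fun_prop, fun y hy => (abs_add_le _ _).trans ?_⟩
  rw [abs_mul, abs_of_nonneg hy.1]
  have := mul_le_mul_of_nonneg_left hy.2 (abs_nonneg a)
  linarith

lemma exp_mul_le_chord (l : ℝ) {y : ℝ} (hy : y ∈ Set.Icc (0 : ℝ) 1) :
    Real.exp (l * y) ≤ 1 - y + y * Real.exp l := by
  have := convexOn_exp.2 (Set.mem_univ 0) (Set.mem_univ l) (sub_nonneg.2 hy.2) hy.1 (by ring)
  simpa [mul_comm] using this

lemma receivedSum_eq {K : ℕ} {S : Type*} [MeasurableSpace S] (F : Forecaster K S)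
    (x : Fin K → ℕ → ℝ) (d : Fin K → ℕ → ℕ) (u : S) (i : Fin K) (t : ℕ) :
    receivedSum F x d u i t =
      received F x d u i t * (receivedSum F x d u i t / received F x d u i t) := by
  rcases eq_or_ne (received F x d u i t) 0 with h | h
  · rw [h, Nat.cast_zero, zero_mul, receivedSum]
    rw [received, Finset.card_eq_zero] at h
    rw [h, Finset.sum_empty]
  · field_simp

lemma receivedSum_div_mem {K : ℕ} {S : Type*} [MeasurableSpace S] (F : Forecaster K S)
    {x : Fin K → ℕ → ℝ} (d : Fin K → ℕ → ℕ) (u : S) (i : Fin K) (t : ℕ)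
    (hx : ∀ s, x i s ∈ Set.Icc (0 : ℝ) 1) :
    receivedSum F x d u i t / received F x d u i t ∈ Set.Icc (0 : ℝ) 1 := by
  refine ⟨div_nonneg (Finset.sum_nonneg fun s _ => (hx s).1) (Nat.cast_nonneg _),
    div_le_one_of_le₀ ?_ (Nat.cast_nonneg _)⟩
  rw [receivedSum, received, Finset.cast_card]
  exact Finset.sum_le_sum fun s _ => (hx s).2

/-- The number of relevant peeling slices times the probability bound of each slice. -/
lemma slices_mul_exp_le {m : ℕ} (hm : 3 ≤ m) :
    ((⌊level m * Real.log m⌋₊ + 1 : ℕ) : ℝ) * Real.exp (-(level m - 1)) ≤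
      15 / (m * Real.log m) := by
  obtain ⟨h1, h2⟩ := level_pos hm
  have hm0 : (0 : ℝ) < m := by exact_mod_cast (by omega : 0 < m)
  set l := Real.log m with hl
  have hll : Real.log l ≤ l := (Real.log_le_sub_one_of_pos (by linarith)).trans (by linarith)
  have hf4 : level m ≤ 4 * l := by
    unfold level
    linarith
  -- At most `5 l²` slices, each of probability at most `e / (m l³)`: the coefficient `3` of `log
  -- log` leaves one factor `1 / l`.
  have hD : ((⌊level m * l⌋₊ + 1 : ℕ) : ℝ) ≤ 5 * l ^ 2 := by
    push_cast
    have := Nat.floor_le (a := level m * l) (by nlinarith)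
    nlinarith
  have hexp : Real.exp (-(level m - 1)) = Real.exp 1 / (m * l ^ 3) := by
    have : -(level m - 1) = 1 - (Real.log m + Real.log l * (3 : ℕ)) := by
      unfold level
      push_cast
      ring
    rw [this, Real.exp_sub, Real.exp_add, Real.exp_log hm0, Real.exp_mul, Real.exp_log (by linarith),
      Real.rpow_natCast]
  rw [hexp]
  have he : Real.exp 1 ≤ 3 := by linarith [Real.exp_one_lt_d9]
  have hl0 : 0 < l := by linarith
  calc _ ≤ 5 * l ^ 2 * (3 / (m * l ^ 3)) := by gcongr
    _ = 15 / (m * l) := by field_simp; norm_num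

/-- The observed event that the index is too small lies in one of finitely many exponential events. -/
lemma exists_slice {s t : ℕ} {q m : ℝ} {l : ℕ → ℝ} (ht : 3 ≤ t) (hst : s ≤ t) (hs : s ≠ 0)
    (hm0 : 0 ≤ m) (hmq : m < q) (hk : level t < s * klReal m q)
    (hl : ∀ k : ℕ, ∀ m, 0 ≤ m → m < q →
      level t * Real.exp (-((k + 1) / level t)) < klReal m q →
      level t * Real.exp (-((k + 1) / level t)) ≤ l k * m - Real.log (1 - q + q * Real.exp (l k))) :
    ∃ k ∈ Finset.range (⌊level t * Real.log t⌋₊ + 1),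
      level t - 1 ≤ s * (l k * m - Real.log (1 - q + q * Real.exp (l k))) := by
  obtain ⟨h1, h2⟩ := level_pos ht
  set f := level t with hf
  have hf0 : 0 < f := by linarith
  have hs1 : (1 : ℝ) ≤ s := by exact_mod_cast Nat.one_le_iff_ne_zero.2 hs
  have hs0 : (0 : ℝ) < s := by linarith
  have hls : 0 ≤ Real.log s := Real.log_nonneg hs1
  have hlst : Real.log s ≤ Real.log t := Real.log_le_log hs0 (by exact_mod_cast hst)
  -- Geometric slices of ratio `exp (1 / f)` in `s`. On slice `k` the threshold `y = f exp (-(k + 1)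
  -- / f)` satisfies `f - 1 ≤ s y < f`, so replacing `s` by the end of its slice costs at most `1`
  -- in the exponent.
  refine ⟨⌊f * Real.log s⌋₊, ?_, ?_⟩
  · rw [Finset.mem_range, Nat.lt_succ_iff]
    exact Nat.floor_le_floor (by gcongr)
  · set k := ⌊f * Real.log s⌋₊
    have hk1 : (k : ℝ) ≤ f * Real.log s := Nat.floor_le (by positivity)
    have hk2 : f * Real.log s < k + 1 := Nat.lt_floor_add_one _
    have hu : s * Real.exp (-((k + 1) / f)) < 1 := by
      rw [Real.exp_neg, ← div_eq_mul_inv, div_lt_one (Real.exp_pos _),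
        ← Real.log_lt_iff_lt_exp hs0, lt_div_iff₀ hf0]
      linarith
    have hlow : 1 - 1 / f ≤ s * Real.exp (-((k + 1) / f)) := by
      have e1 : (s : ℝ) * Real.exp (-((k + 1) / f)) = Real.exp (Real.log s - (k + 1) / f) := by
        rw [sub_eq_add_neg, Real.exp_add, Real.exp_log hs0]
      rw [e1]
      have h3 := Real.add_one_le_exp (Real.log s - (k + 1) / f)
      have h4 : (k + 1 : ℝ) / f ≤ Real.log s + 1 / f := by
        rw [add_div]
        gcongr
        rw [div_le_iff₀ hf0]
        linarith
      linarith
    have hy := hl k m hm0 hmq (by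
      by_contra! hc
      nlinarith)
    calc f - 1 = f * (1 - 1 / f) := by field_simp
      _ ≤ f * (s * Real.exp (-((k + 1) / f))) := by gcongr
      _ = s * (f * Real.exp (-((k + 1) / f))) := by ring
      _ ≤ _ := by gcongr

/-- Each summand is at most an increment of `log log`, so the sum telescopes; the term `1` covers
the first summand. -/
lemma sum_inv_mul_log_le {n : ℕ} (hn : 3 ≤ n) :
    ∑ t ∈ Finset.Ico 2 n, 1 / (((t + 1 : ℕ) : ℝ) * Real.log (t + 1 : ℕ)) ≤
      1 + Real.log (Real.log n) := by
  induction n, hn using Nat.le_induction with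
  | base =>
    obtain ⟨h1, h2⟩ := level_pos le_rfl
    have h3 := Real.log_pos h1
    have : Finset.Ico 2 3 = {2} := rfl
    rw [this, Finset.sum_singleton]
    have h4 : 1 / (((2 + 1 : ℕ) : ℝ) * Real.log (2 + 1 : ℕ)) ≤ 1 := by
      rw [div_le_one (by positivity)]
      push_cast at h1 ⊢
      linarith
    exact h4.trans (le_add_of_nonneg_right h3.le)
  | succ n hn ih =>
    rw [Finset.sum_Ico_succ_top (by omega)]
    have a1 := (level_pos hn).1
    have a2 := (level_pos (hn.trans (Nat.le_succ n))).1
    have hn0 : (0 : ℝ) < n := by exact_mod_cast (by omega : 0 < n)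
    have hn1 : (0 : ℝ) < (n + 1 : ℕ) := by positivity
    set l := Real.log n
    set l' := Real.log (n + 1 : ℕ)
    have e1 : 1 / ((n + 1 : ℕ) : ℝ) ≤ l' - l := by
      have := Real.one_sub_inv_le_log_of_pos (div_pos hn1 hn0)
      rw [Real.log_div hn1.ne' hn0.ne'] at this
      refine le_trans (le_of_eq ?_) this
      push_cast
      field_simp
      ring
    have e2 : (l' - l) / l' ≤ Real.log l' - Real.log l := by
      have hl : 0 < l := by linarith
      have hl' : 0 < l' := by linarith
      have := Real.one_sub_inv_le_log_of_pos (div_pos hl' hl)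
      rw [Real.log_div hl'.ne' hl.ne'] at this
      refine le_trans (le_of_eq ?_) this
      field_simp
    have e3 : 1 / (((n + 1 : ℕ) : ℝ) * l') ≤ (l' - l) / l' := by
      rw [← div_div]
      gcongr
    linarith

/-! ### Counting the plays of a suboptimal prediction -/

section Forecaster

variable {K : ℕ} {S : Type*} [MeasurableSpace S] (F : Forecaster K S)
  (x : Fin K → ℕ → ℝ) (d : Fin K → ℕ → ℕ) (u : S)

/-- The index of `i` on which the prediction of round `t` is based. -/
noncomputable def index (i : Fin K) (t : ℕ) : ℝ :=
  klIndex (received F x d u i t) (receivedSum F x d u i t / received F x d u i t) (t + 1)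

lemma index_le_index_run (hF : IsDelayedKLUCB F) {t : ℕ} (ht : 2 ≤ t) (j : Fin K) :
    index F x d u j t ≤ index F x d u (run F x d u t) t := by
  have := hF t (history F x d u t) u (by omega) j
  rw [← run_eq, empMean_history, empMean_history, numObserved_history, numObserved_history] at this
  exact this

/-- The rounds in which `i` is predicted although at most `r` feedbacks have been received. -/
lemma card_run_eq_le (i : Fin K) (n : ℕ) {r : ℝ} (hr : 0 ≤ r) {Q : Finset ℕ}
    (hQ : ∀ t ∈ Q, t < n ∧ run F x d u t = i ∧ (received F x d u i t : ℝ) ≤ r) :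
    (Q.card : ℝ) ≤ r + maxMissing F x d u i n + 1 := by
  rcases Q.eq_empty_or_nonempty with rfl | hne
  · simp only [Finset.card_empty, Nat.cast_zero]
    positivity
  -- At the last such round the plays so far are at most the received plus the missing feedbacks;
  -- the `1` is that round itself.
  · obtain ⟨h1, h2, h3⟩ := hQ _ (Q.max'_mem hne)
    have h4 := plays_le_received_add F x d u i h1
    have h5 : Q.card ≤ plays F x d u i (Q.max' hne) + 1 := by
      unfold plays
      refine (Finset.card_le_card (t := insert (Q.max' hne) _) fun t ht => ?_).trans
        (Finset.card_insert_le _ _)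
      rw [Finset.mem_insert, Finset.mem_filter, Finset.mem_range]
      rcases (Q.le_max' t ht).eq_or_lt with h | h
      exacts [Or.inl h, Or.inr ⟨h, (hQ t ht).2.1⟩]
    have h6 : (Q.card : ℝ) ≤ received F x d u i (Q.max' hne) + maxMissing F x d u i n + 1 := by
      exact_mod_cast h5.trans (by omega)
    linarith

/-- The predicted index dominates that of `j`, so a play of `i` with the index of `j` at least `q`
needs an index of `i` at least `q`. The `3` consists of the two arbitrary initial rounds and the
last play of this kind. -/
lemma plays_le (hF : IsDelayedKLUCB F) (i j : Fin K) (n : ℕ) {r q : ℝ} (hr : 0 ≤ r)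
    (h : ∀ t, 2 ≤ t → t < n → q ≤ index F x d u i t → (received F x d u i t : ℝ) ≤ r) :
    (plays F x d u i n : ℝ) ≤ 3 + r + maxMissing F x d u i n +
      ∑ t ∈ Finset.Ico 2 n, if index F x d u j t < q then 1 else 0 := by
  classical
  set Q := (Finset.Ico 2 n).filter fun t => run F x d u t = i ∧ q ≤ index F x d u i t with hQ
  set B := (Finset.Ico 2 n).filter fun t => index F x d u j t < q with hB
  have h1 : plays F x d u i n ≤ 2 + B.card + Q.card := by
    unfold plays
    refine (Finset.card_le_card (t := Finset.range 2 ∪ B ∪ Q) fun t ht => ?_).trans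
      ((Finset.card_union_le _ _).trans (Nat.add_le_add_right
        ((Finset.card_union_le _ _).trans (by rw [Finset.card_range])) _))
    rw [Finset.mem_filter, Finset.mem_range] at ht
    simp only [Finset.mem_union, Finset.mem_range, hB, hQ, Finset.mem_filter, Finset.mem_Ico]
    by_cases h2 : t < 2
    · exact Or.inl (Or.inl h2)
    · by_cases h3 : index F x d u j t < q
      · exact Or.inl (Or.inr ⟨⟨by omega, ht.1⟩, h3⟩)
      · have h4 := index_le_index_run F x d u hF (t := t) (by omega) j
        rw [ht.2] at h4
        exact Or.inr ⟨⟨by omega, ht.1⟩, ht.2, (not_lt.1 h3).trans h4⟩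
  have h2 : (Q.card : ℝ) ≤ r + maxMissing F x d u i n + 1 := by
    refine card_run_eq_le F x d u i n hr fun t ht => ?_
    rw [hQ, Finset.mem_filter, Finset.mem_Ico] at ht
    exact ⟨ht.1.2, ht.2.1, h t ht.1.1 ht.1.2 ht.2.2⟩
  have h3 : (plays F x d u i n : ℝ) ≤ 2 + B.card + Q.card := by exact_mod_cast h1
  rw [← Finset.sum_filter, Finset.sum_const, nsmul_eq_mul, mul_one]
  linarith

end Forecaster

/-! ### Probability that an index underestimates its mean -/

namespace IsDelayedBandit

variable {K : ℕ} {Ω S : Type*} [MeasurableSpace Ω] [MeasurableSpace S] {P : Measure Ω}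
  [IsProbabilityMeasure P]
  {μ : Fin K → ℝ} {X : Fin K → ℕ → Ω → ℝ} {τ : Fin K → ℕ → Ω → ℕ} {U : Ω → S}

lemma integrable_reward (hb : IsDelayedBandit P μ X τ U) (i : Fin K) (t : ℕ) :
    Integrable (X i t) P := by
  refine Integrable.of_bound (hb.measurable_reward i t).aestronglyMeasurable 1 ?_
  filter_upwards [hb.mem_Icc i t] with ω hω
  rw [Real.norm_eq_abs, abs_of_nonneg hω.1]
  exact hω.2

lemma mean_mem (hb : IsDelayedBandit P μ X τ U) (i : Fin K) : μ i ∈ Set.Icc (0 : ℝ) 1 := by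
  rw [← hb.mean i 0]
  constructor
  · refine integral_nonneg_of_ae ?_
    filter_upwards [hb.mem_Icc i 0] with ω hω
    exact hω.1
  · have : ∫ ω, X i 0 ω ∂P ≤ ∫ _, (1 : ℝ) ∂P := by
      refine integral_mono_ae (hb.integrable_reward i 0) (integrable_const _) ?_
      filter_upwards [hb.mem_Icc i 0] with ω hω
      exact hω.2
    simpa using this

lemma ae_eq_zero (hb : IsDelayedBandit P μ X τ U) {i : Fin K} (hi : μ i = 0) :
    ∀ᵐ ω ∂P, ∀ t, X i t ω = 0 := by
  refine ae_all_iff.2 fun t => ?_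
  have h0 : 0 ≤ᵐ[P] X i t := by
    filter_upwards [hb.mem_Icc i t] with ω hω
    exact hω.1
  exact (integral_eq_zero_iff_of_nonneg_ae h0 (hb.integrable_reward i t)).1 ((hb.mean i t).trans hi)

lemma ae_eq_one (hb : IsDelayedBandit P μ X τ U) {i : Fin K} (hi : μ i = 1) :
    ∀ᵐ ω ∂P, ∀ t, X i t ω = 1 := by
  refine ae_all_iff.2 fun t => ?_
  have h0 : 0 ≤ᵐ[P] fun ω => 1 - X i t ω := by
    filter_upwards [hb.mem_Icc i t] with ω hω
    exact sub_nonneg.2 hω.2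
  have hint := (integrable_const (μ := P) (1 : ℝ)).sub (hb.integrable_reward i t)
  have h1 : ∫ ω, (1 - X i t ω) ∂P = 0 := by
    rw [integral_sub (integrable_const _) (hb.integrable_reward i t), hb.mean, hi]
    simp
  filter_upwards [(integral_eq_zero_iff_of_nonneg_ae h0 hint).1 h1] with ω hω
  exact (sub_eq_zero.1 hω).symm

lemma integral_affine (hb : IsDelayedBandit P μ X τ U) (i : Fin K) (a b : ℝ) :
    ∫ ω, (a * X i 0 ω + b) ∂P = a * μ i + b := by
  rw [integral_add ((hb.integrable_reward i 0).const_mul a) (integrable_const b),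
    integral_const_mul, hb.mean]
  simp

/-- By convexity the exponential lies below its chord on `[0, 1]`, so the moment generating function
is at most that of the Bernoulli distribution with the same mean. -/
lemma integral_exp_le_one (hb : IsDelayedBandit P μ X τ U) {i : Fin K} (h1 : μ i < 1) (l : ℝ) :
    ∫ ω, Real.exp (l * X i 0 ω + -Real.log (1 - μ i + μ i * Real.exp l)) ∂P ≤ 1 := by
  have h0 := (hb.mean_mem i).1
  have hpos : 0 < 1 - μ i + μ i * Real.exp l := by
    have := mul_nonneg h0 (Real.exp_nonneg l)
    linarith
  simp_rw [Real.exp_add, Real.exp_neg, Real.exp_log hpos]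
  rw [integral_mul_const, ← div_eq_mul_inv, div_le_one hpos]
  have hint := hb.integrable_reward i 0
  have hcalc : ∫ ω, ((Real.exp l - 1) * X i 0 ω + 1) ∂P = 1 - μ i + μ i * Real.exp l := by
    rw [hb.integral_affine]
    ring
  rw [← hcalc]
  refine integral_mono_of_nonneg (Filter.Eventually.of_forall fun ω => Real.exp_nonneg _)
    ((hint.const_mul _).add (integrable_const _)) ?_
  filter_upwards [hb.mem_Icc i 0] with ω hω
  have := exp_mul_le_chord l hω
  linarith

/-- The index of a prediction is unlikely to be smaller than its mean. -/
lemma prob_index_lt_le (hb : IsDelayedBandit P μ X τ U) (F : Forecaster K S) {j : Fin K}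
    (hj : 0 < μ j) {t : ℕ} (ht : 2 ≤ t) :
    P.real {ω | index F (fun i t => X i t ω) (fun i t => τ i t ω) (U ω) j t < μ j} ≤
      15 / (((t + 1 : ℕ) : ℝ) * Real.log (t + 1 : ℕ)) := by
  have ht3 : 3 ≤ t + 1 := by omega
  obtain ⟨hlog, hlev⟩ := level_pos ht3
  rcases (hb.mean_mem j).2.eq_or_lt with h1 | h1
  -- Mean `1` forces all rewards to be `1`, so the empirical mean, or the index without samples, is
  -- already `1`.
  · have : P.real {ω | index F (fun i t => X i t ω) (fun i t => τ i t ω) (U ω) j t < μ j} = 0 := by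
      rw [measureReal_eq_zero_iff, measure_eq_zero_iff_ae_notMem]
      filter_upwards [hb.ae_mem_Icc, hb.ae_eq_one h1] with ω hω h1ω
      simp only [not_lt, h1]
      have hmem := receivedSum_div_mem F (x := fun i t => X i t ω) (fun i t => τ i t ω) (U ω) j t (hω j)
      unfold index
      rcases eq_or_ne (received F (fun i t => X i t ω) (fun i t => τ i t ω) (U ω) j t) 0 with h | h
      · rw [h] at hmem ⊢
        exact klIndex_zero hmem.2 _
      · refine le_trans (le_of_eq ?_) (le_klIndex_self _ hmem.2 _)
        rw [eq_div_iff (by exact_mod_cast h), one_mul, receivedSum]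
        simp only [h1ω]
        rw [Finset.sum_const, nsmul_eq_mul, mul_one]
        rfl
    rw [this]
    positivity
  set f := level (t + 1) with hf
  have hf0 : 0 < f := by linarith
  have hl : ∀ k : ℕ, ∃ l : ℝ, ∀ m, 0 ≤ m → m < μ j →
      f * Real.exp (-((k + 1) / f)) < klReal m (μ j) →
      f * Real.exp (-((k + 1) / f)) ≤ l * m - Real.log (1 - μ j + μ j * Real.exp l) :=
    fun k => exists_chernoff hj h1 (by positivity)
  choose l hl using hl
  set c : ℕ → ℝ := fun k => -Real.log (1 - μ j + μ j * Real.exp (l k)) with hc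
  set H : Ω → StepSeq := fun ω =>
    stepSeq F (fun i t => X i t ω) (fun i t => τ i t ω) (U ω) j t with hH
  have hs : IsSampled P H (X j 0) := hb.isSampled F j t
  set A : ℕ → Set Ω := fun k => {ω | Real.exp (f - 1) ≤
    Real.exp (gateSum (fun _ _ => 1) (fun y => l k * y + c k) (H ω) (t * t))} with hA
  have hAk : ∀ k, P.real (A k) ≤ Real.exp (-(f - 1)) := by
    intro k
    have hφ := isBddFun_affine (l k) (c k)
    have h2 := mul_meas_ge_le_integral_of_nonneg
      (Filter.Eventually.of_forall fun ω => Real.exp_nonneg _)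
      (hs.integrable_predictable ((IsPredictable.const 1).gateSum hφ).exp (t * t))
      (Real.exp (f - 1))
    have h3 := hs.integral_exp_gateSum_le_one hφ (hb.integral_exp_le_one h1 (l k)) (t * t)
    rw [Real.exp_neg, ← one_div, le_div_iff₀ (Real.exp_pos _), mul_comm]
    exact h2.trans h3
  have hsub : ∀ᵐ ω ∂P, ω ∈ {ω | index F (fun i t => X i t ω) (fun i t => τ i t ω) (U ω) j t < μ j} →
      ω ∈ ⋃ k ∈ Finset.range (⌊f * Real.log (t + 1 : ℕ)⌋₊ + 1), A k := by
    filter_upwards [hb.ae_mem_Icc] with ω hω hlt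
    have hmem := receivedSum_div_mem F (x := fun i t => X i t ω) (fun i t => τ i t ω) (U ω) j t (hω j)
    have heq := receivedSum_eq F (fun i t => X i t ω) (fun i t => τ i t ω) (U ω) j t
    simp only [index] at hlt
    have hgs := fun a b => gateSum_affine_stepSeq F (fun i t => X i t ω) (fun i t => τ i t ω) (U ω) j
      (le_refl t) a b
    rw [← receivedSum] at hgs
    set s := received F (fun i t => X i t ω) (fun i t => τ i t ω) (U ω) j t with hsdef
    set Z := receivedSum F (fun i t => X i t ω) (fun i t => τ i t ω) (U ω) j t with hZ
    have hs0 : s ≠ 0 := by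
      intro h0
      rw [h0] at hlt hmem
      linarith [klIndex_zero hmem.2 (t + 1)]
    have hmlt : Z / s < μ j := lt_of_le_of_lt (le_klIndex_self s hmem.2 (t + 1)) hlt
    have hkl : f < s * klReal (Z / s) (μ j) := by
      by_contra! hle
      exact absurd (le_klIndex hmlt.le hj h1 hle) (not_le.2 hlt)
    obtain ⟨k, hk, hkle⟩ := exists_slice (l := l) ht3
      ((received_le F _ _ _ j t).trans (Nat.le_succ t)) hs0 hmem.1 hmlt hkl hl
    rw [Set.mem_iUnion₂]
    refine ⟨k, hk, Real.exp_le_exp.2 (hkle.trans (le_of_eq ?_))⟩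
    rw [hgs, heq]
    simp only [hc]
    field_simp
    ring
  calc _ ≤ P.real (⋃ k ∈ Finset.range (⌊f * Real.log (t + 1 : ℕ)⌋₊ + 1), A k) :=
        ENNReal.toReal_mono (measure_ne_top _ _) (measure_mono_ae hsub)
    _ ≤ ∑ k ∈ Finset.range (⌊f * Real.log (t + 1 : ℕ)⌋₊ + 1), P.real (A k) :=
        measureReal_biUnion_finset_le _ _
    _ ≤ ∑ k ∈ Finset.range (⌊f * Real.log (t + 1 : ℕ)⌋₊ + 1), Real.exp (-(f - 1)) :=
        Finset.sum_le_sum fun k _ => hAk k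
    _ ≤ _ := by
        rw [Finset.sum_const, Finset.card_range, nsmul_eq_mul]
        exact slices_mul_exp_le ht3

end IsDelayedBandit

/-! ### Expected number of plays -/

namespace IsDelayedBandit

variable {K : ℕ} {Ω S : Type*} [MeasurableSpace Ω] [MeasurableSpace S] {P : Measure Ω}
  [IsProbabilityMeasure P]
  {μ : Fin K → ℝ} {X : Fin K → ℕ → Ω → ℝ} {τ : Fin K → ℕ → Ω → ℕ} {U : Ω → S}

lemma integrable_natCast (hb : IsDelayedBandit P μ X τ U) {f : Input K S → ℕ} (hf : Measurable f)
    {n : ℕ} (hn : ∀ p, f p ≤ n) :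
    Integrable (fun ω => (f ((fun i t => X i t ω), (fun i t => τ i t ω), U ω) : ℝ)) P := by
  refine Integrable.of_bound
    (measurable_from_top.comp (hf.comp hb.measurable_input)).aestronglyMeasurable n ?_
  refine Filter.Eventually.of_forall fun ω => ?_
  rw [Real.norm_natCast]
  exact_mod_cast hn _

lemma integrable_plays (hb : IsDelayedBandit P μ X τ U) (F : Forecaster K S) (i : Fin K) (n : ℕ) :
    Integrable (fun ω =>
      (plays F (fun i t => X i t ω) (fun i t => τ i t ω) (U ω) i n : ℝ)) P :=
  hb.integrable_natCast (measurable_plays F i n)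
    fun _ => (Finset.card_filter_le _ _).trans (Finset.card_range n).le

lemma integrable_maxMissing (hb : IsDelayedBandit P μ X τ U) (F : Forecaster K S) (i : Fin K)
    (n : ℕ) :
    Integrable (fun ω =>
      (maxMissing F (fun i t => X i t ω) (fun i t => τ i t ω) (U ω) i n : ℝ)) P :=
  hb.integrable_natCast (measurable_maxMissing F i n) fun _ => maxMissing_le F _ _ _ i n

/-- The expected number of plays of `i`, if the received rewards of `i` lie below an affine level
whenever the index of `i` reaches `μ j`. -/
lemma integral_plays_le (hb : IsDelayedBandit P μ X τ U) {F : Forecaster K S}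
    (hF : IsDelayedKLUCB F) {i j : Fin K} (hj : 0 < μ j) {a b g L : ℝ} (hg : 0 < g)
    (hab : a * μ i + b = g) (hL : 0 ≤ L) {n : ℕ} (hn : 3 ≤ n)
    (h : ∀ᵐ ω ∂P, ∀ t, 2 ≤ t → t < n →
      μ j ≤ index F (fun i t => X i t ω) (fun i t => τ i t ω) (U ω) i t →
      a * receivedSum F (fun i t => X i t ω) (fun i t => τ i t ω) (U ω) i t +
        received F (fun i t => X i t ω) (fun i t => τ i t ω) (U ω) i t * b ≤ L) :
    ∫ ω, (plays F (fun i t => X i t ω) (fun i t => τ i t ω) (U ω) i n : ℝ) ∂P ≤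
      3 + (L / g + passConst g (|a| + |b|)) + expMaxMissing P X τ U F i n +
        15 * (1 + Real.log (Real.log n)) := by
  have hH := hb.isSampled F i n
  obtain ⟨R, hRi, hRle, hR0, hR⟩ := hH.exists_lastPassage (isBddFun_affine a b) hg
    ((hb.integral_affine i a b).trans hab) hL (n * n)
  -- A measurable hull has the same measure, so the event itself need not be shown to be measurable.
  set T : ℕ → Set Ω := fun t => toMeasurable P
    {ω | index F (fun i t => X i t ω) (fun i t => τ i t ω) (U ω) j t < μ j} with hT
  have hTm : ∀ t, MeasurableSet (T t) := fun t => measurableSet_toMeasurable _ _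
  have hTi : ∀ t, Integrable ((T t).indicator fun _ => (1 : ℝ)) P := fun t =>
    (integrable_const 1).indicator (hTm t)
  have hTP : ∀ t, 2 ≤ t → ∫ ω, (T t).indicator (fun _ => (1 : ℝ)) ω ∂P ≤
      15 * (1 / (((t + 1 : ℕ) : ℝ) * Real.log (t + 1 : ℕ))) := by
    intro t ht
    rw [integral_indicator_const _ (hTm t), smul_eq_mul, mul_one, Measure.real, hT,
      measure_toMeasurable, mul_one_div]
    exact hb.prob_index_lt_le F hj ht
  have hGi := hb.integrable_maxMissing F i n
  have hsum : Integrable (fun ω => ∑ t ∈ Finset.Ico 2 n, (T t).indicator (fun _ => (1 : ℝ)) ω) P :=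
    integrable_finsetSum _ fun t _ => hTi t
  have h3 : Integrable (fun ω => 3 + R ω) P := (integrable_const 3).add hRi
  have h4 : Integrable (fun ω => 3 + R ω +
      (maxMissing F (fun i t => X i t ω) (fun i t => τ i t ω) (U ω) i n : ℝ)) P := h3.add hGi
  have hle : ∫ ω, (plays F (fun i t => X i t ω) (fun i t => τ i t ω) (U ω) i n : ℝ) ∂P ≤
      ∫ ω, (3 + R ω + (maxMissing F (fun i t => X i t ω) (fun i t => τ i t ω) (U ω) i n : ℝ) +
        ∑ t ∈ Finset.Ico 2 n, (T t).indicator (fun _ => (1 : ℝ)) ω) ∂P := by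
    refine integral_mono_ae (hb.integrable_plays F i n) (h4.add hsum) ?_
    filter_upwards [h, hR] with ω hω hRω
    refine (plays_le F _ _ _ hF i j n (q := μ j) (hR0 ω) fun t ht1 ht2 hidx => ?_).trans ?_
    · have h5 := hRω (t * n) (Nat.mul_le_mul_right n ht2.le)
      rw [gateSum_affine_stepSeq F _ _ _ i ht2.le, gateSum_one_stepSeq F _ _ _ i ht2.le] at h5
      exact h5 (hω t ht1 ht2 hidx)
    · refine add_le_add_right (Finset.sum_le_sum fun t _ => ?_) _
      split_ifs with hlt
      · rw [Set.indicator_of_mem (subset_toMeasurable P _ hlt)]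
      · exact Set.indicator_nonneg (fun _ _ => zero_le_one) _
  have hTs : ∑ t ∈ Finset.Ico 2 n, ∫ ω, (T t).indicator (fun _ => (1 : ℝ)) ω ∂P ≤
      15 * (1 + Real.log (Real.log n)) := by
    refine (Finset.sum_le_sum fun t ht => hTP t (Finset.mem_Ico.1 ht).1).trans ?_
    rw [← Finset.mul_sum]
    exact mul_le_mul_of_nonneg_left (sum_inv_mul_log_le hn) (by norm_num)
  rw [integral_add h4 hsum, integral_add h3 hGi, integral_add (integrable_const 3) hRi,
    integral_finsetSum _ fun t _ => hTi t, integral_const, probReal_univ, one_smul] at hle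
  change _ ≤ 3 + _ + expMaxMissing P X τ U F i n + _ at hle
  linarith

end IsDelayedBandit

/-- Constants are absorbed by a `log log` term, since `n ≥ 3`. -/
lemma absorb_log_log {C v : ℝ} (hC : 0 ≤ C) {n : ℕ} (hn : 3 ≤ n) (hv : v ≤ C) :
    v ≤ C / Real.log (Real.log 3) * Real.log (Real.log n) := by
  have h3 : (1 : ℝ) < Real.log 3 := by simpa using (level_pos le_rfl).1
  have h0 := Real.log_pos h3
  have h1 : Real.log (Real.log 3) ≤ Real.log (Real.log n) :=
    Real.log_le_log (by linarith) (Real.log_le_log (by norm_num) (by exact_mod_cast hn))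
  rw [div_mul_eq_mul_div, le_div_iff₀ h0]
  nlinarith

lemma passConst_nonneg {g B : ℝ} (hg : 0 < g) (hB : 0 ≤ B) : 0 ≤ passConst g B := by
  unfold passConst
  positivity

/-- A suboptimal prediction is made about `log n / d(μ_i, μ_j)` times, up to an additive `log log`
term and the expected maximal number of missing feedbacks. -/
lemma exists_integral_plays_le.{v, w} {K : ℕ} (μ : Fin K → ℝ) (i j : Fin K) (hij : μ i < μ j) :
    ∃ C : ℝ, 0 ≤ C ∧ ∀ (Ω : Type v) (S : Type w) [MeasurableSpace Ω] [MeasurableSpace S]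
      (P : Measure Ω) [IsProbabilityMeasure P] (X : Fin K → ℕ → Ω → ℝ) (τ : Fin K → ℕ → Ω → ℕ)
      (U : Ω → S) (F : Forecaster K S), IsDelayedBandit P μ X τ U → IsDelayedKLUCB F →
      ∀ n : ℕ, 3 ≤ n →
      ∫ ω, (plays F (fun i t => X i t ω) (fun i t => τ i t ω) (U ω) i n : ℝ) ∂P ≤
        Real.log n * (klBer (μ i) (μ j))⁻¹.toReal + C * Real.log (Real.log n) +
          expMaxMissing P X τ U F i n := by
  have h3 : (1 : ℝ) < Real.log 3 := by simpa using (level_pos le_rfl).1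
  have hl3 := Real.log_pos h3
  by_cases hi0 : 0 ≤ μ i
  swap
  · exact ⟨0, le_rfl, fun Ω S _ _ P _ X τ U F hb => absurd (hb.mean_mem i).1 hi0⟩
  by_cases hj1 : μ j ≤ 1
  swap
  · exact ⟨0, le_rfl, fun Ω S _ _ P _ X τ U F hb => absurd (hb.mean_mem j).2 hj1⟩
  have hj0 : 0 < μ j := hi0.trans_lt hij
  rcases hj1.eq_or_lt with hj1 | hj1
  -- For `μ j = 1` the divergence is infinite and no `log n` term is allowed. The index of `i`
  -- reaches `1` only while all received rewards of `i` equal `1`, that is, while the walk with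
  -- increments `1 - y` is still at `0`.
  · have hg : 0 < 1 - μ i := by linarith
    set D := 18 + passConst (1 - μ i) (|(-1 : ℝ)| + |1|) with hD
    have hD0 : 0 ≤ D := add_nonneg (by norm_num) (passConst_nonneg hg (by positivity))
    refine ⟨D / Real.log (Real.log 3) + 15, by positivity, ?_⟩
    intro Ω S _ _ P _ X τ U F hb hF n hn
    have hmain := hb.integral_plays_le hF (i := i) hj0 hg (a := -1) (b := 1) (by ring) le_rfl hn ?_
    · have h5 := absorb_log_log hD0 hn (le_refl D)
      have h6 : klBer (μ i) (μ j) = ⊤ := by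
        rw [hj1, klBer, if_pos (Or.inr ⟨rfl, by linarith⟩)]
      rw [h6, ENNReal.inv_top, ENNReal.toReal_zero, mul_zero]
      rw [zero_div] at hmain
      linarith
    · filter_upwards [hb.ae_mem_Icc] with ω hω t ht1 ht2 hidx
      have hmem := receivedSum_div_mem F (x := fun i t => X i t ω) (fun i t => τ i t ω) (U ω) i t
        (hω i)
      have heq := receivedSum_eq F (fun i t => X i t ω) (fun i t => τ i t ω) (U ω) i t
      rw [hj1, index] at hidx
      rcases eq_or_ne (received F (fun i t => X i t ω) (fun i t => τ i t ω) (U ω) i t) 0 with h | h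
      · rw [h] at heq ⊢
        rw [heq]
        simp
      · have hlev := level_pos (t := t + 1) (by omega)
        have := eq_one_of_one_le_klIndex (by linarith) h hmem.1 hmem.2 hidx
        rw [this] at heq
        rw [heq]
        linarith
  · set g := klReal (μ i) (μ j) with hg
    have hg0 : 0 < g := klReal_pos hi0 hij hj1
    have hinv : (klBer (μ i) (μ j))⁻¹.toReal = g⁻¹ := by
      rw [klBer_eq hj0 hj1, ENNReal.toReal_inv, ENNReal.toReal_ofReal hg0.le]
    -- For `μ i = 0` the tangent would be vertical; the rewards then vanish almost surely, and the
    -- constant `g` serves as `φ`.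
    obtain ⟨a, ha⟩ : ∃ a : ℝ, (μ i = 0 → a = 0) ∧ (μ i ≠ 0 → a = klSlope (μ i) (μ j)) := by
      by_cases h : μ i = 0
      · exact ⟨0, fun _ => rfl, fun h' => absurd h h'⟩
      · exact ⟨_, fun h' => absurd h' h, fun _ => rfl⟩
    set D := 18 + passConst g (|a| + |g - a * μ i|) with hD
    have hD0 : 0 ≤ D := add_nonneg (by norm_num) (passConst_nonneg hg0 (by positivity))
    -- `D` collects the constants `3`, `15` and `passConst`; `15` comes from the underestimated
    -- indices of `j`, and `3 / g` from the `3 log log n` in the level.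
    refine ⟨D / Real.log (Real.log 3) + 15 + 3 * g⁻¹, by positivity, ?_⟩
    intro Ω S _ _ P _ X τ U F hb hF n hn
    have hlevn := level_pos hn
    have hmain := hb.integral_plays_le hF (i := i) hj0 hg0 (a := a) (b := g - a * μ i) (by ring)
      (L := level n) (by linarith) hn ?_
    · have h5 := absorb_log_log hD0 hn (le_refl D)
      have h6 : level n / g = Real.log n * g⁻¹ + 3 * g⁻¹ * Real.log (Real.log n) := by
        rw [level]
        field_simp
      rw [hinv]
      rw [h6] at hmain
      linarith
    · have hae : ∀ᵐ ω ∂P, μ i = 0 → ∀ t, X i t ω = 0 := by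
        by_cases h : μ i = 0
        · filter_upwards [hb.ae_eq_zero h] with ω hω _ using hω
        · exact Filter.Eventually.of_forall fun ω h' => absurd h' h
      filter_upwards [hb.ae_mem_Icc, hae] with ω hω hω0 t ht1 ht2 hidx
      have hmem := receivedSum_div_mem F (x := fun i t => X i t ω) (fun i t => τ i t ω) (U ω) i t
        (hω i)
      have heq := receivedSum_eq F (fun i t => X i t ω) (fun i t => τ i t ω) (U ω) i t
      have hlev := level_pos (t := t + 1) (by omega)
      have hmono := level_mono (m := t + 1) (n := n) (by omega) (by omega)
      refine le_trans ?_ hmono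
      rw [index] at hidx
      rcases hi0.eq_or_lt with h0 | h0
      · have hz : receivedSum F (fun i t => X i t ω) (fun i t => τ i t ω) (U ω) i t = 0 :=
          Finset.sum_eq_zero fun s _ => hω0 h0.symm s
        rw [hz, zero_div] at hidx
        rw [hz, ha.1 h0.symm, zero_mul, zero_mul, zero_add, sub_zero, hg, ← h0]
        exact mul_klReal_le_of_le_klIndex (by linarith) le_rfl hj0 hj1 hidx
      · have := affine_le_of_le_klIndex (by linarith) hmem.1 hmem.2 h0 hij hj1 hidx
        rw [ha.2 h0.ne']
        refine le_trans (le_of_eq ?_) this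
        nth_rw 1 [heq]
        ring

/-! ### From plays to regret -/

lemma gap_nonneg {K : ℕ} (μ : Fin K → ℝ) (i : Fin K) : 0 ≤ gap μ i :=
  sub_nonneg.2 (le_ciSup (Set.finite_range μ).bddAbove i)

lemma sum_gap_run {K : ℕ} {S : Type*} [MeasurableSpace S] (F : Forecaster K S)
    (x : Fin K → ℕ → ℝ) (d : Fin K → ℕ → ℕ) (u : S) (μ : Fin K → ℝ) (n : ℕ) :
    ∑ t ∈ Finset.range n, gap μ (run F x d u t) = ∑ i, gap μ i * plays F x d u i n := by
  have : ∀ t, gap μ (run F x d u t) = ∑ i, if run F x d u t = i then gap μ i else 0 := by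
    intro t
    simp
  simp_rw [this]
  rw [Finset.sum_comm]
  refine Finset.sum_congr rfl fun i _ => ?_
  rw [← Finset.sum_filter, Finset.sum_const, nsmul_eq_mul, mul_comm]
  rfl

lemma IsDelayedBandit.expRegret_eq {K : ℕ} {Ω S : Type*} [MeasurableSpace Ω] [MeasurableSpace S]
    {P : Measure Ω} [IsProbabilityMeasure P] {μ : Fin K → ℝ} {X : Fin K → ℕ → Ω → ℝ}
    {τ : Fin K → ℕ → Ω → ℕ} {U : Ω → S} (hb : IsDelayedBandit P μ X τ U) (F : Forecaster K S)
    (n : ℕ) :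
    expRegret P μ X τ U F n = ∑ i ∈ Finset.univ.filter (fun i => 0 < gap μ i), gap μ i *
      ∫ ω, (plays F (fun i t => X i t ω) (fun i t => τ i t ω) (U ω) i n : ℝ) ∂P := by
  simp_rw [expRegret, sum_gap_run]
  rw [integral_finsetSum _ fun i _ => (hb.integrable_plays F i n).const_mul _]
  simp_rw [integral_const_mul]
  refine (Finset.sum_filter_of_ne fun i _ h => ?_).symm
  exact lt_of_le_of_ne (gap_nonneg μ i) (Ne.symm (left_ne_zero_of_mul h))

/-- One constant serves all suboptimal predictions. -/
lemma exists_integral_plays_le_leadingTerm.{v, w} {K : ℕ} (μ : Fin K → ℝ) :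
    ∃ C : ℝ, 0 < C ∧ ∀ (Ω : Type v) (S : Type w) [MeasurableSpace Ω] [MeasurableSpace S]
      (P : Measure Ω) [IsProbabilityMeasure P] (X : Fin K → ℕ → Ω → ℝ) (τ : Fin K → ℕ → Ω → ℕ)
      (U : Ω → S) (F : Forecaster K S), IsDelayedBandit P μ X τ U → IsDelayedKLUCB F →
      ∀ n : ℕ, 3 ≤ n → ∀ i, 0 < gap μ i →
      ∫ ω, (plays F (fun i t => X i t ω) (fun i t => τ i t ω) (U ω) i n : ℝ) ∂P ≤
        leadingTerm μ i n + C * Real.log (Real.log n) + expMaxMissing P X τ U F i n := by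
  rcases isEmpty_or_nonempty (Fin K) with hK | hK
  · exact ⟨1, one_pos, fun Ω S _ _ P _ X τ U F _ _ n _ i => isEmptyElim i⟩
  obtain ⟨j, hj⟩ := exists_eq_ciSup_of_finite (f := μ)
  have hex : ∀ i, ∃ C : ℝ, 0 ≤ C ∧ (0 < gap μ i → ∀ (Ω : Type v) (S : Type w) [MeasurableSpace Ω]
      [MeasurableSpace S] (P : Measure Ω) [IsProbabilityMeasure P] (X : Fin K → ℕ → Ω → ℝ)
      (τ : Fin K → ℕ → Ω → ℕ) (U : Ω → S) (F : Forecaster K S), IsDelayedBandit P μ X τ U →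
      IsDelayedKLUCB F → ∀ n : ℕ, 3 ≤ n →
      ∫ ω, (plays F (fun i t => X i t ω) (fun i t => τ i t ω) (U ω) i n : ℝ) ∂P ≤
        leadingTerm μ i n + C * Real.log (Real.log n) + expMaxMissing P X τ U F i n) := by
    intro i
    by_cases hi : 0 < gap μ i
    · have hij : μ i < μ j := by
        rw [hj]
        exact sub_pos.1 hi
      obtain ⟨C, hC0, hC⟩ := exists_integral_plays_le.{v, w} μ i j hij
      refine ⟨C, hC0, fun _ Ω S _ _ P _ X τ U F hb hF n hn => ?_⟩
      have := hC Ω S P X τ U F hb hF n hn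
      rwa [hj] at this
    · exact ⟨0, le_rfl, fun h => absurd h hi⟩
  choose C hC0 hC using hex
  refine ⟨1 + ∑ i, C i, add_pos_of_pos_of_nonneg one_pos (Finset.sum_nonneg fun i _ => hC0 i), ?_⟩
  intro Ω S _ _ P _ X τ U F hb hF n hn i hi
  refine (hC i hi Ω S P X τ U F hb hF n hn).trans ?_
  have h1 : C i ≤ 1 + ∑ i, C i := by
    have := Finset.single_le_sum (fun i _ => hC0 i) (Finset.mem_univ i)
    linarith
  have h2 := mul_le_mul_of_nonneg_right h1 (Real.log_pos (level_pos hn).1).le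
  linarith

end DelayedBandit

theorem theorem4 (K : ℕ) (μ : Fin K → ℝ) :
    ∃ (C₁ : ℝ) (C₂ β : ℝ → ℝ), 0 < C₁ ∧ (∀ ε : ℝ, 0 < ε → 0 < C₂ ε ∧ 0 < β ε) ∧
      Asymptotics.IsBigO (nhdsWithin 0 (Set.Ioi 0)) C₂ (fun ε : ℝ => (ε ^ 2)⁻¹) ∧
      Asymptotics.IsBigO (nhdsWithin 0 (Set.Ioi 0)) β (fun ε : ℝ => ε ^ 2) ∧
      ∀ (Ω S : Type*) [MeasurableSpace Ω] [MeasurableSpace S]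
        (P : MeasureTheory.Measure Ω) [MeasureTheory.IsProbabilityMeasure P]
        (X : Fin K → ℕ → Ω → ℝ) (τ : Fin K → ℕ → Ω → ℕ) (U : Ω → S)
        (F : DelayedBandit.Forecaster K S),
        DelayedBandit.IsDelayedBandit P μ X τ U → DelayedBandit.IsDelayedKLUCB F →
        ∀ (ε : ℝ) (n : ℕ), 0 < ε → 3 ≤ n →
          -- the bound for the non-delayed problem
          ((∀ i t ω, τ i t ω = 0) →
            DelayedBandit.expRegret P μ X τ U F n ≤
              ∑ i ∈ Finset.univ.filter (fun i => 0 < DelayedBandit.gap μ i),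
                DelayedBandit.gap μ i *
                  (DelayedBandit.leadingTerm μ i n * (1 + ε) +
                    C₁ * Real.log (Real.log n) + C₂ ε / (n : ℝ) ^ β ε)) ∧
          -- the bound, with the same constants, for the delayed problem
          DelayedBandit.expRegret P μ X τ U F n ≤
            ∑ i ∈ Finset.univ.filter (fun i => 0 < DelayedBandit.gap μ i),
              DelayedBandit.gap μ i *
                (DelayedBandit.leadingTerm μ i n * (1 + ε) + C₁ * Real.log (Real.log n)) +
            ∑ i, DelayedBandit.gap μ i *
              (C₂ ε / (n : ℝ) ^ β ε * DelayedBandit.expMaxMissing P X τ U F i n +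
                DelayedBandit.expMaxMissing P X τ U F i n + 1) := by
  obtain ⟨C, hC0, hC⟩ := DelayedBandit.exists_integral_plays_le_leadingTerm μ
  -- The bound on the plays has no remainder, so `C₂` and `β` only have to be positive and of the
  -- required orders.
  refine ⟨C, fun ε => (ε ^ 2)⁻¹, fun ε => ε ^ 2, hC0, fun ε hε => ⟨by positivity, by positivity⟩,
    Asymptotics.isBigO_refl _ _, Asymptotics.isBigO_refl _ _, ?_⟩
  intro Ω S _ _ P _ X τ U F hb hF ε n hε hn
  have hplays := hC Ω S P X τ U F hb hF n hn
  have hlog := (DelayedBandit.level_pos hn).1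
  have hlead : ∀ i, DelayedBandit.leadingTerm μ i n ≤ DelayedBandit.leadingTerm μ i n * (1 + ε) := by
    intro i
    have : 0 ≤ DelayedBandit.leadingTerm μ i n :=
      mul_nonneg (by linarith) ENNReal.toReal_nonneg
    nlinarith
  have hrem : 0 ≤ (ε ^ 2)⁻¹ / (n : ℝ) ^ ε ^ 2 := by positivity
  rw [hb.expRegret_eq]
  constructor
  · intro hτ
    refine Finset.sum_le_sum fun i hi => ?_
    rw [Finset.mem_filter] at hi
    refine mul_le_mul_of_nonneg_left ?_ hi.2.le
    have h0 : DelayedBandit.expMaxMissing P X τ U F i n = 0 := by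
      unfold DelayedBandit.expMaxMissing
      simp [DelayedBandit.maxMissing_eq_zero F _ _ _ fun i t => hτ i t _]
    linarith [hplays i hi.2, hlead i]
  · have hG : ∀ i, 0 ≤ DelayedBandit.expMaxMissing P X τ U F i n := fun i =>
      MeasureTheory.integral_nonneg fun ω => Nat.cast_nonneg _
    have hterm : ∀ i, 0 ≤ DelayedBandit.gap μ i * ((ε ^ 2)⁻¹ / (n : ℝ) ^ ε ^ 2 *
        DelayedBandit.expMaxMissing P X τ U F i n + DelayedBandit.expMaxMissing P X τ U F i n + 1) :=
      fun i => mul_nonneg (DelayedBandit.gap_nonneg μ i)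
        (by linarith [mul_nonneg hrem (hG i), hG i])
    refine le_trans ?_ (add_le_add_right (Finset.sum_le_sum_of_subset_of_nonneg
      (Finset.filter_subset (fun i => 0 < DelayedBandit.gap μ i) Finset.univ)
      fun i _ _ => hterm i) _)
    rw [← Finset.sum_add_distrib]
    refine Finset.sum_le_sum fun i hi => ?_
    rw [Finset.mem_filter] at hi
    rw [← mul_add]
    refine mul_le_mul_of_nonneg_left ?_ hi.2.le
    linarith [hplays i hi.2, hlead i, mul_nonneg hrem (hG i)]
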